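/- Let $L$ and $S$ be finite-dimensional quantum systems, $d_L=\dim L$, let $H_L$ and $H_S$ be Hermitian operators on $L$ and $S$, with $H_L$ not a multiple of the identity, and put $\mathcal U_{L,\theta}(X)=e^{-iH_L\theta}Xe^{iH_L\theta}$, $\mathcal U_{S,\theta}(X)=e^{-iH_S\theta}Xe^{iH_S\theta}$, where $e^{-iH_L\theta}$ and $e^{-iH_S\theta}$ are periodic in $\theta$ with a common period $\tau>0$. Let $\mathcal E_{S\leftarrow L}$ (the code) be a quantum channel from $L$ to $S$ and $\mathcal N_S$ (the noise) a quantum channel on $S$ with $\mathcal N_S\circ\mathcal U_{S,\theta}=\mathcal U_{S,\theta}\circ\mathcal N_S$ for all $\theta\in\mathbb R$; put $\mathcal N_{S,\theta}=\mathcal N_S\circ\mathcal U_{S,\theta}$. For states let $f(\rho,\sigma)=\mathrm{Tr}\sqrt{\rho^{1/2}\sigma\rho^{1/2}}$. For channels let $P(\Phi_1,\Phi_2)=\sqrt{1-\min_\rho f((\Phi_1\otimes\mathbb 1)(\rho),(\Phi_2\otimes\mathbb 1)(\rho))^2}$, the minimum being over states $\rho$ of the input system and a reference of the same dimension, and $\overline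 P(\Phi_1,\Phi_2)=\sqrt{1-f((\Phi_1\otimes\mathbb 1)(\Psi),(\Phi_2\otimes\mathbb 1)(\Psi))^2}$ with $\Psi$ the maximally entangled state. With $\mathcal R$ ranging over all channels from $S$ to $L$, let $$\epsilon=\min_{\mathcal R}P(\mathcal R\circ\mathcal N_S\circ\mathcal E_{S\leftarrow L},\mathbb 1_L),\quad \delta_{\mathrm G}=\max_\theta P(\mathcal U_{S,\theta}\circ\mathcal E_{S\leftarrow L},\mathcal E_{S\leftarrow L}\circ\mathcal U_{L,\theta}),\quad \gamma=\min_{\mathcal R}\max_\theta P(\mathcal R\circ\mathcal N_{S,\theta}\circ\mathcal E_{S\leftarrow L},\mathcal U_{L,\theta}),$$ and let $\overline\epsilon,\overline\delta_{\mathrm G},\overline\gamma$ be defined in the same way with $\overline P$ in place of $P$. For a curve of states let $F^{\mathscr R}(\rho_\theta)=\mathrm{Tr}((\partial_\theta\rho_\theta)^2\rho_\theta^{-1})$ (inverse on the support) if the support of $\partial_\theta\rho_\theta$ is contained in that of $\rho_\theta$, and $F^{\mathscr R}(\rho_\theta)=+\infty$ otherwise; for a curve of channels let $F^{\mathscr R}(\Phi_\theta)=\sup_\rho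 F^{\mathscr R}((\Phi_\theta\otimes\mathbb 1)(\rho))\in[0,\infty]$, over input states $\rho$ with an arbitrary finite-dimensional reference. Let $\Delta H_L$ be the difference of the largest and the smallest eigenvalue of $H_L$, and $V=\frac1{d_L}\mathrm{Tr}(H_L^2)-\frac1{d_L^2}\mathrm{Tr}(H_L)^2$. Then, for every $\theta\in\mathbb R$, $$\epsilon+\delta_{\mathrm G}\ \ge\ \gamma\ \ge\ \ell_2\!\left(\frac{\Delta H_L}{\sqrt{4F^{\mathscr R}(\mathcal N_{S,\theta})}}\right),\qquad \overline\epsilon+\overline\delta_{\mathrm G}\ \ge\ \overline\gamma\ \ge\ \ell_3\!\left(\sqrt{\frac{V}{F^{\mathscr R}(\mathcal N_{S,\theta})}}\right).$$ Here $\ell_2(x)=x+O(x^2)$ (as $x\to0^+$) is the inverse of the strictly increasing function $g_2(y)=\dfrac{y}{\sqrt{(1-3y^2+y^4)(1-6\sqrt2\,y^2)}}$ on $[0,b_2)$, $b_2=\frac1{6\sqrt2}$, and $\ell_3(x)=x+O(x^2)$ is the inverse of the strictly increasing function $g_3(y)=\dfrac{y}{\sqrt{(1-3y^2+y^4)\left(1-\frac{3(\Delta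 H_L)^2y}{\sqrt2\,V}\right)}}$ on $[0,b_3)$, $b_3=\frac{\sqrt2\,V}{3(\Delta H_L)^2}$. For $x\in[0,\infty]$ above the range of $g_i$ put $\ell_i(x)=b_i$; the arguments are read as $0$ if $F^{\mathscr R}=\infty$ and as $\infty$ if $F^{\mathscr R}=0$. -/

import Mathlib

open scoped ENNReal Topology ComplexOrder MatrixOrder

noncomputable section

namespace QuantumCode

variable {A B : Type*} [Fintype A] [Fintype B]

/-! ### States and channels on finite-dimensional systems

A system with a fixed orthonormal basis indexed by `A` has observables `Matrix A A ℂ`. -/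

/-- Density matrices. -/
def IsState (ρ : Matrix A A ℂ) : Prop := ρ.PosSemidef ∧ ρ.trace = 1

/-- The map `Φ ⊗ 1_R`: apply `Φ` to every `R`-block. -/
def ampl (R : Type*) (Φ : Matrix A A ℂ →ₗ[ℂ] Matrix B B ℂ) (X : Matrix (A × R) (A × R) ℂ) :
    Matrix (B × R) (B × R) ℂ :=
  Matrix.of fun p q => Φ (Matrix.of fun a a' => X (a, p.2) (a', q.2)) p.1 q.1

/-- Quantum channels: completely positive, trace-preserving linear maps. -/
structure IsChannel (Φ : Matrix A A ℂ →ₗ[ℂ] Matrix B B ℂ) : Prop where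
  completelyPositive : ∀ (k : ℕ) (X : Matrix (A × Fin k) (A × Fin k) ℂ),
    X.PosSemidef → (ampl (Fin k) Φ X).PosSemidef
  tracePreserving : ∀ X : Matrix A A ℂ, (Φ X).trace = X.trace

/-- The map `X ↦ U X U†`. -/
def conjMap (U : Matrix A A ℂ) : Matrix A A ℂ →ₗ[ℂ] Matrix A A ℂ where
  toFun X := U * X * U.conjTranspose
  map_add' X Y := by rw [Matrix.mul_add, Matrix.add_mul]
  map_smul' c X := by simp

section Symmetry

variable [DecidableEq A]

/-- The unitary `U_θ = exp (-i H θ)`. -/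
def evol (H : Matrix A A ℂ) (θ : ℝ) : Matrix A A ℂ :=
  NormedSpace.exp ((-(Complex.I * (θ : ℂ))) • H)

/-- The unitary channel `X ↦ U_θ X U_θ†` with `U_θ = exp (-i H θ)`. -/
def evolChannel (H : Matrix A A ℂ) (θ : ℝ) : Matrix A A ℂ →ₗ[ℂ] Matrix A A ℂ :=
  conjMap (evol H θ)

/-- The difference between the largest and the smallest eigenvalue of `H`. -/
def spread (H : Matrix A A ℂ) : ℝ := sSup (spectrum ℝ H) - sInf (spectrum ℝ H)

/-- The variance of `H` in the maximally mixed state, `Tr(H²)/d - Tr(H)²/d²`. -/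
def mixedVariance (H : Matrix A A ℂ) : ℝ :=
  (H * H).trace.re / (Fintype.card A : ℝ) - H.trace.re ^ 2 / (Fintype.card A : ℝ) ^ 2

/-! ### Fidelity and purified distance -/

/-- The fidelity `Tr √(√ρ σ √ρ)` of two states. -/
def fidelity (ρ σ : Matrix A A ℂ) : ℝ :=
  (CFC.sqrt (CFC.sqrt ρ * σ * CFC.sqrt ρ)).trace.re

/-- The maximally entangled state `|Ψ⟩⟨Ψ|`, `|Ψ⟩ = d^{-1/2} ∑ᵢ |i⟩|i⟩`. -/
def maxEntangled (A : Type*) [Fintype A] [DecidableEq A] : Matrix (A × A) (A × A) ℂ :=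
  Matrix.of fun p q => if p.1 = p.2 ∧ q.1 = q.2 then ((Fintype.card A : ℂ))⁻¹ else 0

variable [DecidableEq B]

/-- The worst-case fidelity of two channels, over inputs that are entangled with a reference
system as large as the input system. -/
def channelFidelity (Φ₁ Φ₂ : Matrix A A ℂ →ₗ[ℂ] Matrix B B ℂ) : ℝ :=
  ⨅ ρ : {ρ : Matrix (A × A) (A × A) ℂ // IsState ρ},
    fidelity (ampl A Φ₁ ρ.1) (ampl A Φ₂ ρ.1)

/-- The fidelity of the Choi states of two channels. -/
def choiFidelity (Φ₁ Φ₂ : Matrix A A ℂ →ₗ[ℂ] Matrix B B ℂ) : ℝ :=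
  fidelity (ampl A Φ₁ (maxEntangled A)) (ampl A Φ₂ (maxEntangled A))

/-- The (worst-case) purified distance of two channels. -/
def purifiedDist (Φ₁ Φ₂ : Matrix A A ℂ →ₗ[ℂ] Matrix B B ℂ) : ℝ :=
  √(1 - channelFidelity Φ₁ Φ₂ ^ 2)

/-- The Choi purified distance of two channels. -/
def choiPurifiedDist (Φ₁ Φ₂ : Matrix A A ℂ →ₗ[ℂ] Matrix B B ℂ) : ℝ :=
  √(1 - choiFidelity Φ₁ Φ₂ ^ 2)

end Symmetry

/-! ### Code quantities -/

section Codes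

variable {L S : Type*} [Fintype L] [DecidableEq L] [Fintype S] [DecidableEq S]

/-- The QEC inaccuracy `ε = min_R P(R ∘ N ∘ E, 1)`. -/
def qecInaccuracy (N : Matrix S S ℂ →ₗ[ℂ] Matrix S S ℂ)
    (E : Matrix L L ℂ →ₗ[ℂ] Matrix S S ℂ) : ℝ :=
  ⨅ R : {R : Matrix S S ℂ →ₗ[ℂ] Matrix L L ℂ // IsChannel R},
    purifiedDist (R.1 ∘ₗ N ∘ₗ E) LinearMap.id

/-- The Choi QEC inaccuracy. -/
def choiQecInaccuracy (N : Matrix S S ℂ →ₗ[ℂ] Matrix S S ℂ)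
    (E : Matrix L L ℂ →ₗ[ℂ] Matrix S S ℂ) : ℝ :=
  ⨅ R : {R : Matrix S S ℂ →ₗ[ℂ] Matrix L L ℂ // IsChannel R},
    choiPurifiedDist (R.1 ∘ₗ N ∘ₗ E) LinearMap.id

/-- The group-global covariance violation `δ_G = max_θ P(U_{S,θ} ∘ E, E ∘ U_{L,θ})`. -/
def covViolation (HL : Matrix L L ℂ) (HS : Matrix S S ℂ)
    (E : Matrix L L ℂ →ₗ[ℂ] Matrix S S ℂ) : ℝ :=
  ⨆ θ : ℝ, purifiedDist (evolChannel HS θ ∘ₗ E) (E ∘ₗ evolChannel HL θ)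

/-- The Choi group-global covariance violation. -/
def choiCovViolation (HL : Matrix L L ℂ) (HS : Matrix S S ℂ)
    (E : Matrix L L ℂ →ₗ[ℂ] Matrix S S ℂ) : ℝ :=
  ⨆ θ : ℝ, choiPurifiedDist (evolChannel HS θ ∘ₗ E) (E ∘ₗ evolChannel HL θ)

/-- The noisy physical gate `N_{S,θ} = N_S ∘ U_{S,θ}`. -/
def noisyGate (N : Matrix S S ℂ →ₗ[ℂ] Matrix S S ℂ) (HS : Matrix S S ℂ) (θ : ℝ) :
    Matrix S S ℂ →ₗ[ℂ] Matrix S S ℂ :=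
  N ∘ₗ evolChannel HS θ

/-- The gate implementation error `γ = min_R max_θ P(R ∘ N_{S,θ} ∘ E, U_{L,θ})`. -/
def gateError (HL : Matrix L L ℂ) (HS : Matrix S S ℂ)
    (N : Matrix S S ℂ →ₗ[ℂ] Matrix S S ℂ) (E : Matrix L L ℂ →ₗ[ℂ] Matrix S S ℂ) : ℝ :=
  ⨅ R : {R : Matrix S S ℂ →ₗ[ℂ] Matrix L L ℂ // IsChannel R},
    ⨆ θ : ℝ, purifiedDist (R.1 ∘ₗ noisyGate N HS θ ∘ₗ E) (evolChannel HL θ)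

/-- The Choi gate implementation error. -/
def choiGateError (HL : Matrix L L ℂ) (HS : Matrix S S ℂ)
    (N : Matrix S S ℂ →ₗ[ℂ] Matrix S S ℂ) (E : Matrix L L ℂ →ₗ[ℂ] Matrix S S ℂ) : ℝ :=
  ⨅ R : {R : Matrix S S ℂ →ₗ[ℂ] Matrix L L ℂ // IsChannel R},
    ⨆ θ : ℝ, choiPurifiedDist (R.1 ∘ₗ noisyGate N HS θ ∘ₗ E) (evolChannel HL θ)

end Codes

/-! ### Right-logarithmic-derivative (RLD) Fisher information -/

section RLD

/-- The derivative of a matrix-valued curve, entry by entry. -/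
def matDeriv (ρ : ℝ → Matrix A A ℂ) (θ : ℝ) : Matrix A A ℂ :=
  Matrix.of fun i j => deriv (fun t => ρ t i j) θ

/-- The inverse of a Hermitian matrix on its support (and zero on its kernel). -/
def supportInv [DecidableEq A] (ρ : Matrix A A ℂ) : Matrix A A ℂ := cfc (fun x : ℝ => x⁻¹) ρ

open Classical in
/-- The RLD Fisher information `Tr((∂ρ)² ρ⁻¹)` of a curve of states if `supp ∂ρ ⊆ supp ρ`
(for Hermitian matrices: `ker ρ ⊆ ker ∂ρ`), and `∞` otherwise. -/
def rldState [DecidableEq A] (ρ : ℝ → Matrix A A ℂ) (θ : ℝ) : ℝ≥0∞ :=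
  if ∀ v : A → ℂ, (ρ θ).mulVec v = 0 → (matDeriv ρ θ).mulVec v = 0 then
    ENNReal.ofReal (matDeriv ρ θ * matDeriv ρ θ * supportInv (ρ θ)).trace.re
  else ∞

/-- The RLD Fisher information of a curve of channels: the supremum over all input states,
possibly entangled with a reference system of any finite dimension. -/
def rldChannel [DecidableEq A] [DecidableEq B]
    (Φ : ℝ → Matrix A A ℂ →ₗ[ℂ] Matrix B B ℂ) (θ : ℝ) : ℝ≥0∞ :=
  ⨆ (n : ℕ) (ρ : {ρ : Matrix (A × Fin n) (A × Fin n) ℂ // IsState ρ}),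
    rldState (fun t => ampl (Fin n) (Φ t) ρ.1) θ

end RLD

/-! ### The bounding functions -/

/-- For `g` strictly increasing on `[0, b)` with `g 0 = 0`: the inverse function of
`g : [0, b) → [0, ∞)`, extended by the value `b` to all `x ∈ [0, ∞]` above the range of `g`. -/
def inverseOn (g : ℝ → ℝ) (b : ℝ) (x : ℝ≥0∞) : ℝ :=
  sSup {y : ℝ | y ∈ Set.Ico 0 b ∧ ENNReal.ofReal (g y) ≤ x}

/-- The right end of the domain of `g₂`. -/
def b₂ : ℝ := 1 / (6 * √2)

/-- The function whose inverse on `[0, b₂)` is `ℓ₂`. -/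
def g₂ (y : ℝ) : ℝ := y / √((1 - 3 * y ^ 2 + y ^ 4) * (1 - 6 * √2 * y ^ 2))

def ell₂ : ℝ≥0∞ → ℝ := inverseOn g₂ b₂

/-- The right end of the domain of `g₃`, where `D = ΔH` and `V` is the variance of `H` in the
maximally mixed state. -/
def b₃ (D V : ℝ) : ℝ := √2 * V / (3 * D ^ 2)

/-- The function whose inverse on `[0, b₃)` is `ℓ₃`. -/
def g₃ (D V y : ℝ) : ℝ :=
  y / √((1 - 3 * y ^ 2 + y ^ 4) * (1 - 3 * D ^ 2 * y / (√2 * V)))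

def ell₃ (D V : ℝ) : ℝ≥0∞ → ℝ := inverseOn (g₃ D V) (b₃ D V)

/-- `ell` is the inverse of the strictly increasing function `g` on `[0, b)`, and
`ell x = x + O(x²)` as `x → 0` from the right. -/
structure IsIncreasingInverse (g : ℝ → ℝ) (b : ℝ) (ell : ℝ≥0∞ → ℝ) : Prop where
  pos : 0 < b
  map_zero : g 0 = 0
  strictMonoOn : StrictMonoOn g (Set.Ico 0 b)
  leftInverse : ∀ y ∈ Set.Ico 0 b, ell (ENNReal.ofReal (g y)) = y
  asymptotic : (fun x : ℝ => ell (ENNReal.ofReal x) - x) =O[𝓝[≥] 0] fun x : ℝ => x ^ 2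

end QuantumCode

end

noncomputable section

namespace QuantumCode

set_option linter.unusedSectionVars false

open Matrix
open scoped Kronecker

/-! ### Support inverses and polar factors -/

section Polar

variable {n m : Type*} [Fintype n] [DecidableEq n] [Fintype m]

/-! The upper bounds on `γ` come from inserting `R ∘ N ∘ E ∘ U_L` between `R ∘ N_θ ∘ E` and `U_L`.
The sine distance `√(1 - F²)` obeys the triangle inequality (`sine_fidelity_triangle`) and shrinks
under channels (`IsChannel.fidelity_le`). Both facts follow from writing the fidelity of two states
as the maximum of `Re Tr X` over positive blocks `(ρ, X; Xᴴ, σ)`.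

For the lower bounds, suppose some recovery `R` keeps the error below `y` at all times. Feed in a
pure test state `ψ` and let `ρ_t` be the recovered output. It stays within `y` of `U_t ψ`, where
`U_t` is generated by `K = H_L ⊗ 1`. In the co-moving frame `M_t = U_tᴴ ρ_t U_t` is periodic, so by
Rolle `Re (i⟨u|M_t|ψ⟩)` is stationary at some `t`, where `u` is the normalised part of `Kψ`
orthogonal to `ψ`. At that time the derivative of `ρ_t` must cancel the commutator with `K`. So its
matrix element between `u` and `ψ` has size about `κ`, the norm of the part of `Kψ` orthogonal to
`ψ`.

The RLD information enters as a positive block `(ρ, D; D, W)` with `Tr W ≤ F`. Channels preserve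
such blocks, so the bound survives the recovery. Cauchy-Schwarz for the block bounds the square of
that matrix element by `⟨u|M_t|u⟩ F`. Since `u ⊥ ψ` and `M_t` is nearly `ψ`, the first factor is at
most `y²`. Hence `κ ≲ y √F` (`fisher_bound_of_periodic`, `rldChannel_noisyGate_bound`).

Superposing extremal eigenvectors gives `κ = ΔH_L / 2`; the maximally entangled state gives `κ =
√V`. The resulting estimates are stronger than those expressed by `g₂` and `g₃`, and elementary
inequalities weaken them to that form (`lt_ofReal_g₂`, `lt_ofReal_g₃`). -/

lemma continuousOn_real_spectrum (A : Matrix n n ℂ) (f : ℝ → ℝ) :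
    ContinuousOn f (spectrum ℝ A) :=
  (Matrix.finite_real_spectrum (A := A)).continuousOn f

lemma supportInv_isHermitian (A : Matrix n n ℂ) : (supportInv A).IsHermitian :=
  (cfc_predicate (p := IsSelfAdjoint) (fun x : ℝ => x⁻¹) A : IsSelfAdjoint _)

variable {A : Matrix n n ℂ}

lemma mul_supportInv (hA : A.IsHermitian) :
    A * supportInv A = cfc (fun x : ℝ => x * x⁻¹) A := by
  have hA' : IsSelfAdjoint A := hA
  rw [cfc_mul (fun x : ℝ => x) (fun x : ℝ => x⁻¹) A (continuousOn_real_spectrum A _)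
    (continuousOn_real_spectrum A _), cfc_id' ℝ A, supportInv]

lemma supportInv_mul (hA : A.IsHermitian) :
    supportInv A * A = cfc (fun x : ℝ => x * x⁻¹) A := by
  have h := congrArg conjTranspose (mul_supportInv hA)
  rw [conjTranspose_mul, hA.eq, (supportInv_isHermitian A).eq] at h
  rw [h]
  exact (cfc_predicate (p := IsSelfAdjoint) (fun x : ℝ => x * x⁻¹) A : IsSelfAdjoint _)

lemma mul_supportInv_mul (hA : A.IsHermitian) : A * supportInv A * A = A := by
  have hA' : IsSelfAdjoint A := hA
  calc A * supportInv A * A = cfc (fun x : ℝ => x * x⁻¹) A * cfc (fun x : ℝ => x) A := by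
        rw [mul_supportInv hA, cfc_id' ℝ A]
    _ = cfc (fun x : ℝ => x * x⁻¹ * x) A :=
        (cfc_mul _ _ A (continuousOn_real_spectrum A _) (continuousOn_real_spectrum A _)).symm
    _ = cfc (fun x : ℝ => x) A := by
        congr 1; ext x; exact mul_inv_mul_cancel x
    _ = A := cfc_id' ℝ A

lemma support_isHermitian (hA : A.IsHermitian) : (A * supportInv A).IsHermitian := by
  rw [IsHermitian, conjTranspose_mul, hA.eq, (supportInv_isHermitian A).eq, supportInv_mul hA,
    mul_supportInv hA]

lemma support_mul_self (hA : A.IsHermitian) :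
    A * supportInv A * (A * supportInv A) = A * supportInv A := by
  rw [← mul_assoc, mul_supportInv_mul hA]

/-- The range of `B` lies in that of `A`: with `P` the support projector, `(P B - B)(P B - B)ᴴ`
expands to zero because `P` fixes `B Bᴴ = A²`. -/
lemma support_mul_of_mul_conjTranspose (hA : A.IsHermitian) {B : Matrix n m ℂ}
    (h : A * A = B * Bᴴ) : A * supportInv A * B = B := by
  have hP := support_isHermitian hA
  have h0 : (A * supportInv A * B - B) * (A * supportInv A * B - B)ᴴ = 0 := by
    rw [conjTranspose_sub, conjTranspose_mul, hP.eq]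
    have e1 : A * supportInv A * (B * Bᴴ) = B * Bᴴ := by
      rw [← h, ← mul_assoc, mul_supportInv_mul hA]
    have e2 : B * Bᴴ * (A * supportInv A) = B * Bᴴ := by
      simpa [conjTranspose_mul, hP.eq] using congrArg conjTranspose e1
    have e3 : A * supportInv A * B * (Bᴴ * (A * supportInv A)) = B * Bᴴ := by
      rw [Matrix.mul_assoc (A * supportInv A), ← Matrix.mul_assoc B, e2, e1]
    rw [Matrix.sub_mul, Matrix.mul_sub, Matrix.mul_sub, e3, ← Matrix.mul_assoc B, e2,
      Matrix.mul_assoc (A * supportInv A) B, e1]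
    simp
  exact sub_eq_zero.mp (self_mul_conjTranspose_eq_zero.mp h0)

/-- Polar decomposition: if `S = √(B Bᴴ)`, then `B = S V` and `S = B Vᴴ` for a contraction `V`. -/
lemma exists_polar (hA : A.IsHermitian) {B : Matrix n m ℂ} (h : A * A = B * Bᴴ) :
    ∃ V : Matrix n m ℂ, A * V = B ∧ B * Vᴴ = A ∧ (1 - V * Vᴴ).PosSemidef := by
  have hP := support_isHermitian hA
  have hI := supportInv_isHermitian A
  have hcomm : supportInv A * A = A * supportInv A := by
    rw [supportInv_mul hA, mul_supportInv hA]
  -- For this factor `V Vᴴ` is the support projector of `A`. A contraction suffices, so no extension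
  -- to a unitary is made.
  refine ⟨supportInv A * B, ?_, ?_, ?_⟩
  · rw [← Matrix.mul_assoc, support_mul_of_mul_conjTranspose hA h]
  · rw [conjTranspose_mul, ← Matrix.mul_assoc, ← h, hI.eq, mul_assoc, ← hcomm, ← mul_assoc,
      mul_supportInv_mul hA]
  · have e : supportInv A * B * (supportInv A * B)ᴴ = A * supportInv A := by
      rw [conjTranspose_mul, hI.eq, Matrix.mul_assoc, ← Matrix.mul_assoc B, ← h, ← mul_assoc, ← mul_assoc,
        hcomm, mul_supportInv_mul hA]
    rw [e]
    have : 1 - A * supportInv A = (1 - A * supportInv A) * (1 - A * supportInv A)ᴴ := by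
      rw [conjTranspose_sub, hP.eq, conjTranspose_one, mul_sub, sub_mul, sub_mul,
        support_mul_self hA]
      simp
    rw [this]
    exact posSemidef_self_mul_conjTranspose _

lemma one_sub_mul_conjTranspose_posSemidef {k : Type*} [Fintype k] [DecidableEq m] {U : Matrix n m ℂ}
    {W : Matrix m k ℂ} (hU : (1 - U * Uᴴ).PosSemidef) (hW : (1 - W * Wᴴ).PosSemidef) :
    (1 - U * W * (U * W)ᴴ).PosSemidef := by
  have e : 1 - U * W * (U * W)ᴴ = (1 - U * Uᴴ) + U * (1 - W * Wᴴ) * Uᴴ := by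
    rw [conjTranspose_mul]
    simp only [Matrix.mul_sub, Matrix.sub_mul, Matrix.mul_one, Matrix.mul_assoc]
    abel
  rw [e]
  exact hU.add (hW.mul_mul_conjTranspose_same U)

end Polar

/-! ### Trace inequalities for the Hilbert-Schmidt form -/

section Trace

variable {n m k : Type*} [Fintype n] [Fintype m] [Fintype k]

lemma re_trace_nonneg {A : Matrix n n ℂ} (hA : A.PosSemidef) : 0 ≤ A.trace.re :=
  (Complex.le_def.mp hA.trace_nonneg).1

lemma re_trace_le_of_sub {A B : Matrix n n ℂ} (h : (B - A).PosSemidef) :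
    A.trace.re ≤ B.trace.re := by
  have := re_trace_nonneg h
  rw [trace_sub, Complex.sub_re] at this
  linarith

lemma re_trace_mul_conjTranspose_comm (P Q : Matrix n m ℂ) :
    (Q * Pᴴ).trace.re = (P * Qᴴ).trace.re := by
  have : Q * Pᴴ = (P * Qᴴ)ᴴ := by simp
  rw [this, trace_conjTranspose]
  simp

lemma two_mul_re_trace_le (P Q : Matrix n m ℂ) :
    2 * (P * Qᴴ).trace.re ≤ (P * Pᴴ).trace.re + (Q * Qᴴ).trace.re := by
  have h := re_trace_nonneg (posSemidef_self_mul_conjTranspose (P - Q))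
  rw [conjTranspose_sub, Matrix.mul_sub, Matrix.sub_mul, Matrix.sub_mul] at h
  simp only [trace_sub, Complex.sub_re] at h
  have := re_trace_mul_conjTranspose_comm P Q
  linarith

end Trace

/-! ### Square roots of positive matrices -/

section Sqrt

variable {n : Type*} [Fintype n] [DecidableEq n] {ρ : Matrix n n ℂ}

lemma sqrt_posSemidef (ρ : Matrix n n ℂ) : (CFC.sqrt ρ).PosSemidef :=
  nonneg_iff_posSemidef.mp (CFC.sqrt_nonneg ρ)

lemma sqrt_mul_sqrt (hρ : ρ.PosSemidef) : CFC.sqrt ρ * CFC.sqrt ρ = ρ :=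
  CFC.sqrt_mul_sqrt_self ρ (nonneg_iff_posSemidef.mpr hρ)

lemma exists_mul_conjTranspose (hρ : ρ.PosSemidef) : ∃ Q : Matrix n n ℂ, Q * Qᴴ = ρ :=
  ⟨CFC.sqrt ρ, by rw [(sqrt_posSemidef ρ).isHermitian.eq, sqrt_mul_sqrt hρ]⟩

lemma re_trace_mul_nonneg {A B : Matrix n n ℂ} (hA : A.PosSemidef) (hB : B.PosSemidef) :
    0 ≤ (A * B).trace.re := by
  obtain ⟨Q, rfl⟩ := exists_mul_conjTranspose hB
  rw [← Matrix.mul_assoc, trace_mul_comm, ← Matrix.mul_assoc]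
  simpa using re_trace_nonneg (hA.conjTranspose_mul_mul_same Q)

end Sqrt

/-! ### The fidelity through positive block matrices -/

section Fidelity

variable {n m k : Type*} [Fintype n] [DecidableEq n] [Fintype m] [DecidableEq m]
  [Fintype k] [DecidableEq k] {ρ σ τ : Matrix n n ℂ}

lemma fromBlocks_diagonal_posSemidef {D : Matrix n n ℂ} {F : Matrix m m ℂ}
    (hD : D.PosSemidef) (hF : F.PosSemidef) : (fromBlocks D 0 0 F).PosSemidef := by
  obtain ⟨P, rfl⟩ := exists_mul_conjTranspose hD
  obtain ⟨Q, rfl⟩ := exists_mul_conjTranspose hF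
  have : fromBlocks (P * Pᴴ) 0 0 (Q * Qᴴ) = fromBlocks P 0 0 Q * (fromBlocks P 0 0 Q)ᴴ := by
    simp [fromBlocks_conjTranspose, fromBlocks_multiply]
  rw [this]
  exact posSemidef_self_mul_conjTranspose _

/-- A Gram matrix plus a positive diagonal. The slack in `ρ - A Aᴴ` is needed because polar factors
are only contractions. -/
lemma fromBlocks_posSemidef_of_le {A C : Matrix n k ℂ} (hA : (ρ - A * Aᴴ).PosSemidef)
    (hC : (σ - C * Cᴴ).PosSemidef) :
    (fromBlocks ρ (A * Cᴴ) (A * Cᴴ)ᴴ σ).PosSemidef := by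
  have e : fromBlocks ρ (A * Cᴴ) (A * Cᴴ)ᴴ σ =
      fromBlocks A (0 : Matrix n k ℂ) C (0 : Matrix n k ℂ) *
        (fromBlocks A (0 : Matrix n k ℂ) C (0 : Matrix n k ℂ))ᴴ
        + fromBlocks (ρ - A * Aᴴ) 0 0 (σ - C * Cᴴ) := by
    simp [fromBlocks_conjTranspose, fromBlocks_multiply, fromBlocks_add]
  rw [e]
  exact (posSemidef_self_mul_conjTranspose _).add (fromBlocks_diagonal_posSemidef hA hC)

lemma exists_gram_of_fromBlocks {X : Matrix n n ℂ} (h : (fromBlocks ρ X Xᴴ σ).PosSemidef) :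
    ∃ A B : Matrix n (n ⊕ n) ℂ, A * Aᴴ = ρ ∧ A * Bᴴ = X ∧ B * Bᴴ = σ := by
  obtain ⟨Q, hQ⟩ := exists_mul_conjTranspose h
  refine ⟨Q.submatrix Sum.inl id, Q.submatrix Sum.inr id, ?_, ?_, ?_⟩
  · ext i j; exact congrFun₂ hQ (Sum.inl i) (Sum.inl j)
  · ext i j; exact congrFun₂ hQ (Sum.inl i) (Sum.inr j)
  · ext i j; exact congrFun₂ hQ (Sum.inr i) (Sum.inr j)

lemma fidelity_nonneg (ρ σ : Matrix n n ℂ) : 0 ≤ fidelity ρ σ :=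
  re_trace_nonneg (sqrt_posSemidef _)

/-- `U` is the polar factor of `√ρ √σ`, whose modulus `√(√ρ σ √ρ)` has the fidelity as its trace. -/
lemma exists_fidelity_polar (ρ : Matrix n n ℂ) (hσ : σ.PosSemidef) :
    ∃ U : Matrix n n ℂ, (1 - U * Uᴴ).PosSemidef ∧
      CFC.sqrt (CFC.sqrt ρ * σ * CFC.sqrt ρ) * U = CFC.sqrt ρ * CFC.sqrt σ ∧
      fidelity ρ σ = (CFC.sqrt ρ * U * CFC.sqrt σ).trace.re := by
  have hr := (sqrt_posSemidef ρ).isHermitian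
  have hs := (sqrt_posSemidef σ).isHermitian
  have hpos : (CFC.sqrt ρ * σ * CFC.sqrt ρ).PosSemidef := by
    simpa [hr.eq] using hσ.mul_mul_conjTranspose_same (CFC.sqrt ρ)
  set M := CFC.sqrt (CFC.sqrt ρ * σ * CFC.sqrt ρ) with hM
  have hMh : M.IsHermitian := (sqrt_posSemidef _).isHermitian
  have hMM : M * M = CFC.sqrt ρ * CFC.sqrt σ * (CFC.sqrt ρ * CFC.sqrt σ)ᴴ := by
    rw [hM, sqrt_mul_sqrt hpos, conjTranspose_mul, hr.eq, hs.eq, mul_assoc (CFC.sqrt ρ) (CFC.sqrt σ),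
      ← mul_assoc (CFC.sqrt σ) (CFC.sqrt σ), sqrt_mul_sqrt hσ, mul_assoc]
  obtain ⟨U, hU1, hU2, hU3⟩ := exists_polar hMh hMM
  refine ⟨U, hU3, hU1, ?_⟩
  have hU4 : U * (CFC.sqrt σ * CFC.sqrt ρ) = M := by
    have := congrArg conjTranspose hU2
    simpa [conjTranspose_mul, hr.eq, hs.eq, hMh.eq] using this
  rw [fidelity, ← hM, ← hU4, ← mul_assoc, trace_mul_comm, mul_assoc]

/-- Write `A = √ρ V`, `B = √σ W` with contractions and `√ρ √σ = M U`. Then `Tr (A Bᴴ)` is the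
Hilbert-Schmidt product of `√M V` and `√M U W`, both of squared norm at most `Tr M`, the fidelity.
-/
lemma re_trace_le_fidelity_of_gram {A B : Matrix n k ℂ} (hA : A * Aᴴ = ρ) (hB : B * Bᴴ = σ) :
    (A * Bᴴ).trace.re ≤ fidelity ρ σ := by
  have hρ : ρ.PosSemidef := hA ▸ posSemidef_self_mul_conjTranspose A
  have hσ : σ.PosSemidef := hB ▸ posSemidef_self_mul_conjTranspose B
  have hr := (sqrt_posSemidef ρ).isHermitian
  have hs := (sqrt_posSemidef σ).isHermitian
  obtain ⟨U, hU, hMU, -⟩ := exists_fidelity_polar ρ hσ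
  set M := CFC.sqrt (CFC.sqrt ρ * σ * CFC.sqrt ρ) with hM
  have hMp : M.PosSemidef := sqrt_posSemidef _
  have hUM : Uᴴ * M = CFC.sqrt σ * CFC.sqrt ρ := by
    simpa [conjTranspose_mul, hr.eq, hs.eq, hMp.isHermitian.eq] using congrArg conjTranspose hMU
  obtain ⟨V, hV1, -, hV⟩ := exists_polar hr ((sqrt_mul_sqrt hρ).trans hA.symm)
  obtain ⟨W, hW1, -, hW⟩ := exists_polar hs ((sqrt_mul_sqrt hσ).trans hB.symm)
  set N := CFC.sqrt M
  have hN : N.IsHermitian := (sqrt_posSemidef _).isHermitian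
  have hNN : N * N = M := sqrt_mul_sqrt hMp
  have hle : ∀ {Z : Matrix n k ℂ}, (1 - Z * Zᴴ).PosSemidef →
      (N * Z * (N * Z)ᴴ).trace.re ≤ M.trace.re := by
    intro Z hZ
    apply re_trace_le_of_sub
    have e : M - N * Z * (N * Z)ᴴ = N * (1 - Z * Zᴴ) * Nᴴ := by
      rw [conjTranspose_mul, hN.eq, mul_sub, sub_mul, mul_one, hNN]
      simp only [Matrix.mul_assoc]
    rw [e]
    exact hZ.mul_mul_conjTranspose_same N
  have key : (A * Bᴴ).trace = (N * V * (N * (U * W))ᴴ).trace := by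
    calc (A * Bᴴ).trace = (CFC.sqrt ρ * (V * Wᴴ * CFC.sqrt σ)).trace := by
          rw [← hV1, ← hW1, conjTranspose_mul, hs.eq]
          simp only [Matrix.mul_assoc]
      _ = (V * Wᴴ * Uᴴ * (N * N)).trace := by
          rw [trace_mul_comm, hNN, Matrix.mul_assoc _ Uᴴ, hUM]
          simp only [Matrix.mul_assoc]
      _ = (N * V * (N * (U * W))ᴴ).trace := by
          rw [← Matrix.mul_assoc, trace_mul_comm, conjTranspose_mul, conjTranspose_mul, hN.eq]
          simp only [Matrix.mul_assoc]
  have h1 := two_mul_re_trace_le (N * V) (N * (U * W))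
  have h2 := hle hV
  have h3 := hle (one_sub_mul_conjTranspose_posSemidef hU hW)
  rw [key, fidelity]
  linarith

/-- Together with `exists_fromBlocks_fidelity` this gives the variational formula from which
symmetry and monotonicity are read off. -/
lemma re_trace_le_fidelity {X : Matrix n n ℂ} (h : (fromBlocks ρ X Xᴴ σ).PosSemidef) :
    X.trace.re ≤ fidelity ρ σ := by
  obtain ⟨A, B, hA, rfl, hB⟩ := exists_gram_of_fromBlocks h
  exact re_trace_le_fidelity_of_gram hA hB

/-- The second factor `√σ` depends on `σ` alone, so the optimisers for two pairs sharing `σ` can be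
compared in the triangle inequality. -/
lemma exists_re_trace_eq_fidelity (hρ : ρ.PosSemidef) (hσ : σ.PosSemidef) :
    ∃ A C : Matrix n n ℂ, (ρ - A * Aᴴ).PosSemidef ∧ C * Cᴴ = σ ∧ C = CFC.sqrt σ ∧
      (A * Cᴴ).trace.re = fidelity ρ σ := by
  obtain ⟨U, hU, -, h⟩ := exists_fidelity_polar ρ hσ
  have hr := (sqrt_posSemidef ρ).isHermitian
  have hs := (sqrt_posSemidef σ).isHermitian
  refine ⟨CFC.sqrt ρ * U, CFC.sqrt σ, ?_, by rw [hs.eq, sqrt_mul_sqrt hσ], rfl, ?_⟩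
  · have e : ρ - CFC.sqrt ρ * U * (CFC.sqrt ρ * U)ᴴ
        = CFC.sqrt ρ * (1 - U * Uᴴ) * (CFC.sqrt ρ)ᴴ := by
      rw [conjTranspose_mul, hr.eq, mul_sub, sub_mul, mul_one, sqrt_mul_sqrt hρ]
      simp only [mul_assoc]
    rw [e]
    exact hU.mul_mul_conjTranspose_same _
  · rw [hs.eq, h]

lemma exists_fromBlocks_fidelity (hρ : ρ.PosSemidef) (hσ : σ.PosSemidef) :
    ∃ X : Matrix n n ℂ, (fromBlocks ρ X Xᴴ σ).PosSemidef ∧ X.trace.re = fidelity ρ σ := by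
  obtain ⟨A, C, hA, hC, -, h⟩ := exists_re_trace_eq_fidelity hρ hσ
  refine ⟨A * Cᴴ, fromBlocks_posSemidef_of_le hA ?_, h⟩
  rw [hC, sub_self]
  exact PosSemidef.zero

lemma fidelity_le_comm (hρ : ρ.PosSemidef) (hσ : σ.PosSemidef) :
    fidelity ρ σ ≤ fidelity σ ρ := by
  obtain ⟨X, hX, h⟩ := exists_fromBlocks_fidelity hρ hσ
  have h' : (fromBlocks σ Xᴴ Xᴴᴴ ρ).PosSemidef := by
    have := hX.submatrix (Equiv.sumComm n n)
    simpa [Matrix.fromBlocks_submatrix_sum_swap_sum_swap] using this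
  rw [← h]
  have := re_trace_le_fidelity h'
  rwa [trace_conjTranspose, Complex.star_def, Complex.conj_re] at this

lemma fidelity_comm (hρ : ρ.PosSemidef) (hσ : σ.PosSemidef) :
    fidelity ρ σ = fidelity σ ρ :=
  le_antisymm (fidelity_le_comm hρ hσ) (fidelity_le_comm hσ hρ)

lemma re_dotProduct_sq_le {w ψ : n → ℂ} (hψ : star ψ ⬝ᵥ ψ = 1) :
    (star w ⬝ᵥ ψ).re ^ 2 ≤ (star w ⬝ᵥ w).re := by
  set f : ℝ := (star w ⬝ᵥ ψ).re with hf
  have h : 0 ≤ star (w - (f : ℂ) • ψ) ⬝ᵥ (w - (f : ℂ) • ψ) := dotProduct_star_self_nonneg _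
  have h' := (Complex.le_def.mp h).1
  have hc : (star ψ ⬝ᵥ w).re = f := by
    rw [hf, ← Complex.conj_re (star w ⬝ᵥ ψ), ← Complex.star_def, ← star_dotProduct_star, star_star]
  simp only [star_sub, star_smul, sub_dotProduct, dotProduct_sub, smul_dotProduct,
    dotProduct_smul, hψ, Complex.star_def, Complex.conj_ofReal, smul_eq_mul, Complex.sub_re,
    Complex.mul_re, Complex.ofReal_re, Complex.ofReal_im, Complex.zero_re, hc, ← hf] at h'
  simp at h'
  nlinarith

/-- The fidelity with a pure state. -/
lemma fidelity_vecMulVec_sq_le (hρ : ρ.PosSemidef) {ψ : n → ℂ} (hψ : star ψ ⬝ᵥ ψ = 1) :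
    fidelity ρ (vecMulVec ψ (star ψ)) ^ 2 ≤ (star ψ ⬝ᵥ ρ *ᵥ ψ).re := by
  have hP : (vecMulVec ψ (star ψ)).PosSemidef := posSemidef_vecMulVec_self_star ψ
  obtain ⟨A, C, hA, -, hC, h⟩ := exists_re_trace_eq_fidelity hρ hP
  have hsq : CFC.sqrt (vecMulVec ψ (star ψ)) = vecMulVec ψ (star ψ) := by
    refine CFC.sqrt_unique ?_ (nonneg_iff_posSemidef.mpr hP)
    rw [vecMulVec_mul_vecMulVec, hψ, one_smul]
  rw [hsq] at hC
  -- A pure state is its own square root, so the optimal trace is the inner product of `Aᴴ ψ` with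
  -- the unit vector `ψ`. Cauchy-Schwarz and `A Aᴴ ≤ ρ` then finish.
  have hz : (A * Cᴴ).trace = star (Aᴴ *ᵥ ψ) ⬝ᵥ ψ := by
    rw [hC, hP.isHermitian.eq, mul_vecMulVec, trace_vecMulVec, star_mulVec,
      conjTranspose_conjTranspose, ← dotProduct_mulVec, dotProduct_comm]
  have h1 := re_dotProduct_sq_le (w := Aᴴ *ᵥ ψ) hψ
  have h2 := (Complex.le_def.mp (hA.dotProduct_mulVec_nonneg ψ)).1
  have h3 : star (Aᴴ *ᵥ ψ) ⬝ᵥ (Aᴴ *ᵥ ψ) = star ψ ⬝ᵥ (A * Aᴴ) *ᵥ ψ := by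
    rw [star_mulVec, conjTranspose_conjTranspose, ← dotProduct_mulVec, mulVec_mulVec]
  rw [← h, hz]
  rw [h3] at h1
  rw [sub_mulVec, dotProduct_sub, Complex.sub_re, Complex.zero_re] at h2
  linarith

/-- With `r = cos α` and `s = cos β` this is `sin (α + β) ≤ sin α + sin β`. It is trivial if `p + q
≥ 1`; otherwise `p q ≤ r s`, so the lower bound on `t` may be squared. -/
lemma sine_triangle_real {r s t p q : ℝ} (hr : 0 ≤ r) (hs : 0 ≤ s) (hp : 0 ≤ p) (hq : 0 ≤ q)
    (hrp : r ^ 2 + p ^ 2 = 1) (hsq : s ^ 2 + q ^ 2 = 1) (ht : r * s - p * q ≤ t) :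
    √(1 - t ^ 2) ≤ p + q := by
  rw [Real.sqrt_le_left (by positivity)]
  rcases le_or_gt 1 (p + q) with h | h
  · nlinarith [sq_nonneg t]
  · have h1 : p ^ 2 + q ^ 2 ≤ 1 := by nlinarith [mul_nonneg hp hq]
    have h2 : p * q ≤ r * s := by
      apply abs_le_of_sq_le_sq' _ (by positivity) |>.2
      nlinarith
    have h3 : r * s ≤ 1 := by nlinarith [sq_nonneg (r - s)]
    have h4 : (r * s - p * q) ^ 2 ≤ t ^ 2 := by
      apply pow_le_pow_left₀ (by linarith) ht
    have h5 : r * s * (p * q) ≤ p * q := by nlinarith [mul_nonneg hp hq]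
    have h6 : r ^ 2 * s ^ 2 = (1 - p ^ 2) * (1 - q ^ 2) := by
      rw [show 1 - p ^ 2 = r ^ 2 by linarith, show 1 - q ^ 2 = s ^ 2 by linarith]
    nlinarith [sq_nonneg (p * q)]

lemma re_trace_mul_conjTranspose_sq_le (P Q : Matrix n m ℂ) :
    (P * Qᴴ).trace.re ^ 2 ≤ (P * Pᴴ).trace.re * (Q * Qᴴ).trace.re := by
  have h : ∀ t : ℝ, 0 ≤ (Q * Qᴴ).trace.re * (t * t) + (-2 * (P * Qᴴ).trace.re) * t
      + (P * Pᴴ).trace.re := by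
    intro t
    have := two_mul_re_trace_le P ((t : ℂ) • Q)
    simp only [conjTranspose_smul, Matrix.mul_smul, Matrix.smul_mul, trace_smul,
      Complex.star_def, Complex.conj_ofReal, smul_eq_mul, Complex.re_ofReal_mul] at this
    linarith
  have := discrim_le_zero h
  rw [discrim] at this
  nlinarith

/-- The sine distance `√(1 - F²)` satisfies the triangle inequality. -/
lemma sine_fidelity_triangle (hρ : IsState ρ) (hσ : IsState σ) (hτ : IsState τ) :
    √(1 - fidelity ρ τ ^ 2) ≤ √(1 - fidelity ρ σ ^ 2) + √(1 - fidelity σ τ ^ 2) := by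
  obtain ⟨A, B, hA, hB, hBσ, hAB⟩ := exists_re_trace_eq_fidelity hρ.1 hσ.1
  obtain ⟨C, B', hC, -, hB'σ, hCB⟩ := exists_re_trace_eq_fidelity hτ.1 hσ.1
  obtain rfl : B = B' := hBσ.trans hB'σ.symm
  rw [fidelity_comm hτ.1 hσ.1] at hCB
  have hA1 : (A * Aᴴ).trace.re ≤ 1 := by simpa [hρ.2] using re_trace_le_of_sub hA
  have hC1 : (C * Cᴴ).trace.re ≤ 1 := by simpa [hτ.2] using re_trace_le_of_sub hC
  have hB1 : (B * Bᴴ).trace.re = 1 := by simp [hB, hσ.2]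
  have hAC := re_trace_le_fidelity (fromBlocks_posSemidef_of_le hA hC)
  set r := fidelity ρ σ with hr
  set s := fidelity σ τ with hs
  have hr0 : 0 ≤ r := fidelity_nonneg _ _
  have hs0 : 0 ≤ s := fidelity_nonneg _ _
  have hr1 : r ^ 2 ≤ 1 := by
    have := re_trace_mul_conjTranspose_sq_le A B
    rw [hAB, hB1] at this
    linarith
  have hs1 : s ^ 2 ≤ 1 := by
    have := re_trace_mul_conjTranspose_sq_le C B
    rw [hCB, hB1] at this
    linarith
  refine sine_triangle_real hr0 hs0 (Real.sqrt_nonneg _) (Real.sqrt_nonneg _)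
    (by rw [Real.sq_sqrt (by linarith)]; ring) (by rw [Real.sq_sqrt (by linarith)]; ring)
    (le_trans ?_ hAC)
  -- Remove from `A` and `C` their components along the unit vector `B`. The remainders have squared
  -- norms at most `1 - r²` and `1 - s²`, so Cauchy-Schwarz controls `Re Tr (A Cᴴ) - r s`.
  have hcs := re_trace_mul_conjTranspose_sq_le (A - (r : ℂ) • B) (C - (s : ℂ) • B)
  simp only [conjTranspose_sub, conjTranspose_smul, Matrix.mul_sub, Matrix.sub_mul,
    Matrix.mul_smul, Matrix.smul_mul, trace_sub, trace_smul, Complex.star_def,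
    Complex.conj_ofReal, smul_eq_mul, Complex.sub_re, Complex.re_ofReal_mul, hAB, hCB, hB1,
    re_trace_mul_conjTranspose_comm A B, re_trace_mul_conjTranspose_comm C B] at hcs
  rw [← Real.sqrt_mul (by linarith)]
  have h1 : ((A * Cᴴ).trace.re - r * s) ^ 2 ≤ (1 - r ^ 2) * (1 - s ^ 2) := by
    refine le_trans (le_of_eq ?_) (hcs.trans (mul_le_mul ?_ ?_ ?_ ?_))
    · ring
    · nlinarith
    · nlinarith
    · have := re_trace_mul_conjTranspose_sq_le C B
      rw [hCB, hB1] at this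
      linarith
    · linarith
  have := Real.abs_le_sqrt h1
  linarith [neg_le_of_abs_le this]

end Fidelity

/-! ### Amplifications of channels -/

section Ampl

variable {A B C R R' : Type*} [Fintype A] [Fintype B] [Fintype C] [Fintype R] [Fintype R']

lemma ampl_submatrix (Φ : Matrix A A ℂ →ₗ[ℂ] Matrix B B ℂ) (e : R' → R)
    (X : Matrix (A × R) (A × R) ℂ) :
    ampl R' Φ (X.submatrix (Prod.map id e) (Prod.map id e)) =
      (ampl R Φ X).submatrix (Prod.map id e) (Prod.map id e) := rfl

lemma ampl_comp (Φ : Matrix B B ℂ →ₗ[ℂ] Matrix C C ℂ) (Ψ : Matrix A A ℂ →ₗ[ℂ] Matrix B B ℂ)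
    (X : Matrix (A × R) (A × R) ℂ) : ampl R (Φ ∘ₗ Ψ) X = ampl R Φ (ampl R Ψ X) := rfl

variable {Φ : Matrix A A ℂ →ₗ[ℂ] Matrix B B ℂ}

lemma IsChannel.ampl_posSemidef (hΦ : IsChannel Φ) {X : Matrix (A × R) (A × R) ℂ}
    (hX : X.PosSemidef) : (ampl R Φ X).PosSemidef := by
  let e := Fintype.equivFin R
  have h := (hΦ.completelyPositive _ _ (hX.submatrix (Prod.map id e.symm))).submatrix
    (Prod.map id e)
  rw [ampl_submatrix] at h
  simpa [submatrix_submatrix, Prod.map_comp_map] using h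

lemma IsChannel.trace_ampl (hΦ : IsChannel Φ) (X : Matrix (A × R) (A × R) ℂ) :
    (ampl R Φ X).trace = X.trace := by
  simp only [trace, diag_apply, Fintype.sum_prod_type_right]
  exact Finset.sum_congr rfl fun r _ =>
    hΦ.tracePreserving (Matrix.of fun a a' => X (a, r) (a', r))

lemma IsChannel.isState_ampl (hΦ : IsChannel Φ) {X : Matrix (A × R) (A × R) ℂ}
    (hX : IsState X) : IsState (ampl R Φ X) :=
  ⟨hΦ.ampl_posSemidef hX.1, by rw [hΦ.trace_ampl, hX.2]⟩

lemma IsChannel.comp {Ψ : Matrix B B ℂ →ₗ[ℂ] Matrix C C ℂ} (hΨ : IsChannel Ψ)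
    (hΦ : IsChannel Φ) : IsChannel (Ψ ∘ₗ Φ) :=
  ⟨fun _ _ hX => hΨ.ampl_posSemidef (hΦ.ampl_posSemidef hX),
    fun X => (hΨ.tracePreserving _).trans (hΦ.tracePreserving X)⟩

lemma isChannel_id : IsChannel (LinearMap.id : Matrix A A ℂ →ₗ[ℂ] Matrix A A ℂ) :=
  ⟨fun _ _ hX => hX, fun _ => rfl⟩

lemma ampl_fromBlocks (Φ : Matrix A A ℂ →ₗ[ℂ] Matrix B B ℂ)
    (P Q S T : Matrix (A × R) (A × R) ℂ) :
    (ampl (R ⊕ R) Φ ((fromBlocks P Q S T).submatrix (Equiv.prodSumDistrib A R R)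
      (Equiv.prodSumDistrib A R R))).submatrix (Equiv.prodSumDistrib B R R).symm
        (Equiv.prodSumDistrib B R R).symm =
      fromBlocks (ampl R Φ P) (ampl R Φ Q) (ampl R Φ S) (ampl R Φ T) := by
  ext (⟨b, r⟩ | ⟨b, r⟩) (⟨b', r'⟩ | ⟨b', r'⟩) <;> rfl

/-- A two-by-two block matrix is an operator with doubled reference `R ⊕ R`, so this is complete
positivity. It yields data processing for both the fidelity and the RLD information. -/
lemma IsChannel.fromBlocks_posSemidef (hΦ : IsChannel Φ) {P Q S T : Matrix (A × R) (A × R) ℂ}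
    (h : (fromBlocks P Q S T).PosSemidef) :
    (fromBlocks (ampl R Φ P) (ampl R Φ Q) (ampl R Φ S) (ampl R Φ T)).PosSemidef := by
  rw [← ampl_fromBlocks]
  exact (hΦ.ampl_posSemidef (h.submatrix _)).submatrix _

lemma fromBlocks_conjTranspose_eq {n : Type*} {P Q S T : Matrix n n ℂ}
    [Fintype n] (h : (fromBlocks P Q S T).PosSemidef) : S = Qᴴ := by
  have := h.isHermitian
  rw [IsHermitian, fromBlocks_conjTranspose, fromBlocks_inj] at this
  exact this.2.2.1.symm

/-- The fidelity increases under a channel. -/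
lemma IsChannel.fidelity_le [DecidableEq A] [DecidableEq B] [DecidableEq R] (hΦ : IsChannel Φ)
    {ρ σ : Matrix (A × R) (A × R) ℂ} (hρ : ρ.PosSemidef) (hσ : σ.PosSemidef) :
    fidelity ρ σ ≤ fidelity (ampl R Φ ρ) (ampl R Φ σ) := by
  obtain ⟨X, hX, h⟩ := exists_fromBlocks_fidelity hρ hσ
  have hX' := hΦ.fromBlocks_posSemidef hX
  rw [fromBlocks_conjTranspose_eq hX'] at hX'
  rw [← h, ← hΦ.trace_ampl X]
  exact re_trace_le_fidelity hX'

end Ampl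

/-! ### Unitary conjugations, operations on the reference, preparation channels -/

section Conj

variable {A B R : Type*} [Fintype A] [DecidableEq A] [Fintype B] [DecidableEq B]
  [Fintype R] [DecidableEq R]

lemma fidelity_le_conj {U ρ σ : Matrix A A ℂ} (hU : Uᴴ * U = 1) (hρ : ρ.PosSemidef)
    (hσ : σ.PosSemidef) : fidelity ρ σ ≤ fidelity (U * ρ * Uᴴ) (U * σ * Uᴴ) := by
  obtain ⟨X, hX, h⟩ := exists_fromBlocks_fidelity hρ hσ
  have hX' := hX.mul_mul_conjTranspose_same (fromBlocks U 0 0 U)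
  simp only [fromBlocks_conjTranspose, fromBlocks_multiply, Matrix.zero_mul, Matrix.mul_zero,
    add_zero, zero_add, conjTranspose_zero] at hX'
  rw [fromBlocks_conjTranspose_eq hX'] at hX'
  have := re_trace_le_fidelity hX'
  rwa [trace_mul_comm, ← Matrix.mul_assoc, hU, Matrix.one_mul, h] at this

lemma ampl_conjMap (U : Matrix A A ℂ) (X : Matrix (A × R) (A × R) ℂ) :
    ampl R (conjMap U) X = (U ⊗ₖ (1 : Matrix R R ℂ)) * X * (U ⊗ₖ (1 : Matrix R R ℂ))ᴴ := by
  ext ⟨a, r⟩ ⟨a', r'⟩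
  simp [ampl, conjMap, Matrix.mul_apply, Fintype.sum_prod_type, Matrix.one_apply,
    Finset.sum_ite_eq, apply_ite]

lemma isChannel_conjMap {U : Matrix A A ℂ} (hU : Uᴴ * U = 1) : IsChannel (conjMap U) where
  completelyPositive k X hX := by
    rw [ampl_conjMap]
    exact hX.mul_mul_conjTranspose_same _
  tracePreserving X := by
    change (U * X * Uᴴ).trace = _
    rw [trace_mul_comm, ← Matrix.mul_assoc, hU, Matrix.one_mul]

lemma conj_reference_apply (V : Matrix R R ℂ) (X : Matrix (A × R) (A × R) ℂ) (p q : A × R) :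
    (((1 : Matrix A A ℂ) ⊗ₖ V) * X * ((1 : Matrix A A ℂ) ⊗ₖ V)ᴴ) p q =
      ∑ r', ∑ r, (V p.2 r * star (V q.2 r')) * X (p.1, r) (q.1, r') := by
  obtain ⟨a, r⟩ := p
  obtain ⟨a', r'⟩ := q
  simp [Matrix.mul_apply, Fintype.sum_prod_type, Matrix.one_apply, Finset.sum_mul, apply_ite]
  exact Finset.sum_congr rfl fun _ _ => Finset.sum_congr rfl fun _ _ => by ring

/-- A linear map that acts on the system commutes with a conjugation of the reference. -/
lemma ampl_conj_reference (Φ : Matrix A A ℂ →ₗ[ℂ] Matrix B B ℂ) (V : Matrix R R ℂ)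
    (X : Matrix (A × R) (A × R) ℂ) :
    ampl R Φ (((1 : Matrix A A ℂ) ⊗ₖ V) * X * ((1 : Matrix A A ℂ) ⊗ₖ V)ᴴ) =
      ((1 : Matrix B B ℂ) ⊗ₖ V) * ampl R Φ X * ((1 : Matrix B B ℂ) ⊗ₖ V)ᴴ := by
  ext p q
  have e : (Matrix.of fun a a' => (((1 : Matrix A A ℂ) ⊗ₖ V) * X *
      ((1 : Matrix A A ℂ) ⊗ₖ V)ᴴ) (a, p.2) (a', q.2)) =
      ∑ r', ∑ r, (V p.2 r * star (V q.2 r')) • Matrix.of fun a a' => X (a, r) (a', r') := by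
    ext a a'
    simp only [of_apply, conj_reference_apply, Matrix.sum_apply, Matrix.smul_apply, of_apply, smul_eq_mul]
  rw [conj_reference_apply]
  simp only [ampl, of_apply] at e ⊢
  rw [e]
  simp only [map_sum, map_smul, Matrix.sum_apply, Matrix.smul_apply, smul_eq_mul]

/-- The channel that discards its input and prepares a basis state. -/
def prepare (A : Type*) [Fintype A] (b : B) : Matrix A A ℂ →ₗ[ℂ] Matrix B B ℂ :=
  (LinearMap.toSpanSingleton ℂ _ (Matrix.single b b 1)) ∘ₗ Matrix.traceLinearMap A ℂ ℂ

/-- Complete positivity is shown by the Kraus operators `|b⟩⟨a|`. The channel serves to make the set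
of recoveries nonempty. -/
lemma isChannel_prepare (b : B) : IsChannel (prepare A b) where
  completelyPositive k X hX := by
    have e : ampl (Fin k) (prepare A b) X = ∑ a, (Matrix.single b b 1 ⊗ₖ
        (1 : Matrix (Fin k) (Fin k) ℂ)) * X.submatrix (fun p : B × Fin k => (a, p.2))
          (fun p : B × Fin k => (a, p.2)) * (Matrix.single b b 1 ⊗ₖ
        (1 : Matrix (Fin k) (Fin k) ℂ))ᴴ := by
      ext ⟨c, r⟩ ⟨c', r'⟩
      rcases eq_or_ne b c with rfl | h <;> rcases eq_or_ne b c' with rfl | h' <;>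
      simp [ampl, prepare, Matrix.mul_apply, Fintype.sum_prod_type, Matrix.one_apply,
        Matrix.single_apply, Matrix.sum_apply, trace, apply_ite, *]
    rw [e]
    exact posSemidef_sum _ fun a _ => (hX.submatrix _).mul_mul_conjTranspose_same _
  tracePreserving X := by simp [prepare]

end Conj

/-! ### Hamiltonian evolution -/

section Evol

variable {A : Type*} [Fintype A] [DecidableEq A]

lemma evol_zero (H : Matrix A A ℂ) : evol H 0 = 1 := by simp [evol]

lemma evol_add (H : Matrix A A ℂ) (s t : ℝ) : evol H (s + t) = evol H s * evol H t := by
  rw [evol, evol, evol, ← Matrix.exp_add_of_commute _ _ ((Commute.refl H).smul_left _ |>.smul_right _),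
    ← add_smul]
  congr 2
  push_cast
  ring

lemma evol_conjTranspose {H : Matrix A A ℂ} (hH : H.IsHermitian) (t : ℝ) :
    (evol H t)ᴴ = evol H (-t) := by
  rw [evol, ← Matrix.exp_conjTranspose, conjTranspose_smul, hH.eq, evol]
  congr 2
  simp

lemma evol_conjTranspose_mul {H : Matrix A A ℂ} (hH : H.IsHermitian) (t : ℝ) :
    (evol H t)ᴴ * evol H t = 1 := by
  rw [evol_conjTranspose hH, ← evol_add, neg_add_cancel, evol_zero]

lemma isChannel_evolChannel {H : Matrix A A ℂ} (hH : H.IsHermitian) (t : ℝ) :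
    IsChannel (evolChannel H t) :=
  isChannel_conjMap (evol_conjTranspose_mul hH t)

end Evol

/-! ### Pure states and the maximally entangled vector -/

section Pure

variable {A B : Type*} [Fintype A] [Fintype B]

lemma mul_vecMulVec_star_mul (U : Matrix B A ℂ) (v : A → ℂ) :
    U * vecMulVec v (star v) * Uᴴ = vecMulVec (U *ᵥ v) (star (U *ᵥ v)) := by
  rw [mul_vecMulVec, vecMulVec_mul, star_mulVec]

lemma isState_vecMulVec {v : A → ℂ} (hv : star v ⬝ᵥ v = 1) : IsState (vecMulVec v (star v)) :=
  ⟨posSemidef_vecMulVec_self_star v, by rw [trace_vecMulVec, dotProduct_comm, hv]⟩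

variable [DecidableEq A]

/-- The state vector `d^{-1/2} ∑ᵢ |i⟩|i⟩`. -/
def maxVec (A : Type*) [Fintype A] [DecidableEq A] (p : A × A) : ℂ :=
  if p.1 = p.2 then ((√(Fintype.card A : ℝ) : ℝ) : ℂ)⁻¹ else 0

lemma inv_sqrt_mul_inv_sqrt {d : ℝ} (hd : 0 ≤ d) :
    ((√d : ℝ) : ℂ)⁻¹ * ((√d : ℝ) : ℂ)⁻¹ = (d : ℂ)⁻¹ := by
  rw [← mul_inv, ← Complex.ofReal_mul, Real.mul_self_sqrt hd]

lemma maxEntangled_eq : maxEntangled A = vecMulVec (maxVec A) (star (maxVec A)) := by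
  ext p q
  have h := inv_sqrt_mul_inv_sqrt (Nat.cast_nonneg (α := ℝ) (Fintype.card A))
  by_cases h1 : p.1 = p.2 <;> by_cases h2 : q.1 = q.2 <;>
    simp [maxEntangled, maxVec, vecMulVec_apply, h1, h2]
  simpa using h.symm

lemma star_maxVec_dotProduct [Nonempty A] : star (maxVec A) ⬝ᵥ maxVec A = 1 := by
  have h := inv_sqrt_mul_inv_sqrt (Nat.cast_nonneg (α := ℝ) (Fintype.card A))
  have hc : (Fintype.card A : ℂ) ≠ 0 := Nat.cast_ne_zero.mpr Fintype.card_ne_zero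
  simp only [dotProduct, Fintype.sum_prod_type, maxVec, Pi.star_apply, apply_ite star, star_zero,
    mul_ite, ite_mul, zero_mul, mul_zero]
  simp [Finset.sum_ite_eq, h, hc]

lemma isState_maxEntangled [Nonempty A] : IsState (maxEntangled A) := by
  rw [maxEntangled_eq]
  exact isState_vecMulVec star_maxVec_dotProduct

lemma kronecker_one_mulVec_maxVec (U : Matrix A A ℂ) :
    (U ⊗ₖ (1 : Matrix A A ℂ)) *ᵥ maxVec A = ((1 : Matrix A A ℂ) ⊗ₖ Uᵀ) *ᵥ maxVec A := by
  ext ⟨a, b⟩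
  simp [mulVec, dotProduct, Fintype.sum_prod_type, maxVec, Matrix.one_apply]

/-- A local operation on one half of the maximally entangled state equals the transposed operation
on the other half. -/
lemma conj_maxEntangled (U : Matrix A A ℂ) :
    (U ⊗ₖ (1 : Matrix A A ℂ)) * maxEntangled A * (U ⊗ₖ (1 : Matrix A A ℂ))ᴴ =
      ((1 : Matrix A A ℂ) ⊗ₖ Uᵀ) * maxEntangled A * ((1 : Matrix A A ℂ) ⊗ₖ Uᵀ)ᴴ := by
  rw [maxEntangled_eq, mul_vecMulVec_star_mul, mul_vecMulVec_star_mul,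
    kronecker_one_mulVec_maxVec]

end Pure

/-! ### Purified distances of channels -/

section Distance

variable {A B C : Type*} [Fintype A] [DecidableEq A] [Fintype B] [DecidableEq B]
  [Fintype C] [DecidableEq C] {Φ₁ Φ₂ Φ₃ : Matrix A A ℂ →ₗ[ℂ] Matrix B B ℂ}

lemma channelFidelity_nonneg : 0 ≤ channelFidelity Φ₁ Φ₂ :=
  Real.iInf_nonneg fun _ => fidelity_nonneg _ _

lemma channelFidelity_le {ρ : Matrix (A × A) (A × A) ℂ} (hρ : IsState ρ) :
    channelFidelity Φ₁ Φ₂ ≤ fidelity (ampl A Φ₁ ρ) (ampl A Φ₂ ρ) :=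
  ciInf_le (f := fun ρ : {ρ : Matrix (A × A) (A × A) ℂ // IsState ρ} =>
    fidelity (ampl A Φ₁ ρ.1) (ampl A Φ₂ ρ.1))
    ⟨0, by rintro _ ⟨_, rfl⟩; exact fidelity_nonneg _ _⟩ ⟨ρ, hρ⟩

lemma sqrt_one_sub_sq_le_one (x : ℝ) : √(1 - x ^ 2) ≤ 1 := by
  exact Real.sqrt_le_one.mpr (by linarith [sq_nonneg x])

/-- Reduces the worst-case distance to single inputs without showing that the infimum is attained.
For `c < 1` the uniform bound `√(1 - c²)` on fidelities passes to the infimum; for `c ≥ 1` there is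
nothing to prove. -/
lemma purifiedDist_le_iff [Nonempty A] {c : ℝ} (hc : 0 ≤ c) :
    purifiedDist Φ₁ Φ₂ ≤ c ↔ ∀ ρ : Matrix (A × A) (A × A) ℂ, IsState ρ →
      √(1 - fidelity (ampl A Φ₁ ρ) (ampl A Φ₂ ρ) ^ 2) ≤ c := by
  constructor
  · intro h ρ hρ
    refine le_trans (Real.sqrt_le_sqrt ?_) h
    have := pow_le_pow_left₀ channelFidelity_nonneg (channelFidelity_le (Φ₁ := Φ₁) (Φ₂ := Φ₂) hρ) 2
    linarith
  · intro h
    rcases le_or_gt 1 c with h1 | h1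
    · exact (sqrt_one_sub_sq_le_one _).trans h1
    · have : Nonempty {ρ : Matrix (A × A) (A × A) ℂ // IsState ρ} :=
        ⟨⟨_, isState_maxEntangled⟩⟩
      have h2 : √(1 - c ^ 2) ≤ channelFidelity Φ₁ Φ₂ := by
        refine le_ciInf fun ρ => ?_
        have := h ρ.1 ρ.2
        rw [Real.sqrt_le_left hc] at this
        exact Real.sqrt_le_iff.mpr ⟨fidelity_nonneg _ _, by linarith⟩
      have h3 := (Real.sqrt_le_iff.mp h2).2
      exact Real.sqrt_le_iff.mpr ⟨hc, by linarith⟩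

lemma sine_fidelity_le_purifiedDist [Nonempty A] {ρ : Matrix (A × A) (A × A) ℂ}
    (hρ : IsState ρ) :
    √(1 - fidelity (ampl A Φ₁ ρ) (ampl A Φ₂ ρ) ^ 2) ≤ purifiedDist Φ₁ Φ₂ :=
  (purifiedDist_le_iff (Real.sqrt_nonneg _)).mp le_rfl ρ hρ

lemma purifiedDist_triangle [Nonempty A] (h₁ : IsChannel Φ₁) (h₂ : IsChannel Φ₂)
    (h₃ : IsChannel Φ₃) :
    purifiedDist Φ₁ Φ₃ ≤ purifiedDist Φ₁ Φ₂ + purifiedDist Φ₂ Φ₃ :=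
  (purifiedDist_le_iff (add_nonneg (Real.sqrt_nonneg _) (Real.sqrt_nonneg _))).mpr fun _ hρ =>
    (sine_fidelity_triangle (h₁.isState_ampl hρ) (h₂.isState_ampl hρ) (h₃.isState_ampl hρ)).trans
      (add_le_add (sine_fidelity_le_purifiedDist hρ) (sine_fidelity_le_purifiedDist hρ))

lemma sqrt_one_sub_sq_anti {x y : ℝ} (hx : 0 ≤ x) (h : x ≤ y) : √(1 - y ^ 2) ≤ √(1 - x ^ 2) :=
  Real.sqrt_le_sqrt (by have := pow_le_pow_left₀ hx h 2; linarith)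

lemma purifiedDist_comp_left [Nonempty A] (h₁ : IsChannel Φ₁) (h₂ : IsChannel Φ₂)
    {Ψ : Matrix B B ℂ →ₗ[ℂ] Matrix C C ℂ} (hΨ : IsChannel Ψ) :
    purifiedDist (Ψ ∘ₗ Φ₁) (Ψ ∘ₗ Φ₂) ≤ purifiedDist Φ₁ Φ₂ :=
  (purifiedDist_le_iff (Real.sqrt_nonneg _)).mpr fun _ hρ =>
    (sqrt_one_sub_sq_anti (fidelity_nonneg _ _)
      (hΨ.fidelity_le (h₁.isState_ampl hρ).1 (h₂.isState_ampl hρ).1)).trans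
      (sine_fidelity_le_purifiedDist hρ)

lemma purifiedDist_comp_right [Nonempty A] {Ψ : Matrix A A ℂ →ₗ[ℂ] Matrix A A ℂ}
    (hΨ : IsChannel Ψ) : purifiedDist (Φ₁ ∘ₗ Ψ) (Φ₂ ∘ₗ Ψ) ≤ purifiedDist Φ₁ Φ₂ :=
  (purifiedDist_le_iff (Real.sqrt_nonneg _)).mpr fun _ hρ => by
    rw [ampl_comp, ampl_comp]
    exact sine_fidelity_le_purifiedDist (hΨ.isState_ampl hρ)

lemma choiPurifiedDist_triangle [Nonempty A] (h₁ : IsChannel Φ₁) (h₂ : IsChannel Φ₂)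
    (h₃ : IsChannel Φ₃) :
    choiPurifiedDist Φ₁ Φ₃ ≤ choiPurifiedDist Φ₁ Φ₂ + choiPurifiedDist Φ₂ Φ₃ :=
  sine_fidelity_triangle (h₁.isState_ampl isState_maxEntangled)
    (h₂.isState_ampl isState_maxEntangled) (h₃.isState_ampl isState_maxEntangled)

lemma choiPurifiedDist_comp_left [Nonempty A] (h₁ : IsChannel Φ₁) (h₂ : IsChannel Φ₂)
    {Ψ : Matrix B B ℂ →ₗ[ℂ] Matrix C C ℂ} (hΨ : IsChannel Ψ) :
    choiPurifiedDist (Ψ ∘ₗ Φ₁) (Ψ ∘ₗ Φ₂) ≤ choiPurifiedDist Φ₁ Φ₂ :=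
  sqrt_one_sub_sq_anti (fidelity_nonneg _ _)
    (hΨ.fidelity_le (h₁.isState_ampl isState_maxEntangled).1
      (h₂.isState_ampl isState_maxEntangled).1)

/-- Only unitaries are admitted, since the input must stay maximally entangled up to a local
operation. On that input `U` acts as `Uᵀ` on the reference, where it commutes with both channels and
does not lower the fidelity on removal. -/
lemma choiPurifiedDist_comp_conjMap [Nonempty A] (h₁ : IsChannel Φ₁) (h₂ : IsChannel Φ₂)
    {U : Matrix A A ℂ} (hU : Uᴴ * U = 1) :
    choiPurifiedDist (Φ₁ ∘ₗ conjMap U) (Φ₂ ∘ₗ conjMap U) ≤ choiPurifiedDist Φ₁ Φ₂ := by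
  refine sqrt_one_sub_sq_anti (fidelity_nonneg _ _) ?_
  have hV : ((1 : Matrix B B ℂ) ⊗ₖ Uᵀ)ᴴ * ((1 : Matrix B B ℂ) ⊗ₖ Uᵀ) = 1 := by
    have hU' : (Uᵀ)ᴴ * Uᵀ = 1 := by
      have : U * Uᴴ = 1 := mul_eq_one_comm.mp hU
      simpa [transpose_mul, conjTranspose, transpose_map] using congrArg transpose this
    rw [conjTranspose_kronecker, ← mul_kronecker_mul, hU', conjTranspose_one, one_mul,
      one_kronecker_one]
  have h := fidelity_le_conj hV (h₁.isState_ampl isState_maxEntangled).1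
    (h₂.isState_ampl isState_maxEntangled).1
  rwa [choiFidelity, choiFidelity, ampl_comp, ampl_comp, ampl_conjMap, conj_maxEntangled,
    ampl_conj_reference, ampl_conj_reference]

end Distance

/-! ### The triangle bound on the gate error -/

section Upper

variable {L S : Type*} [Fintype L] [DecidableEq L] [Fintype S] [DecidableEq S]
  {HL : Matrix L L ℂ} {HS : Matrix S S ℂ} {E : Matrix L L ℂ →ₗ[ℂ] Matrix S S ℂ}
  {N : Matrix S S ℂ →ₗ[ℂ] Matrix S S ℂ}

lemma nonempty_channel [Nonempty L] :
    Nonempty {R : Matrix S S ℂ →ₗ[ℂ] Matrix L L ℂ // IsChannel R} :=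
  ⟨⟨prepare S (Classical.arbitrary L), isChannel_prepare _⟩⟩

lemma bddAbove_purifiedDist {A B : Type*} [Fintype A] [DecidableEq A] [Fintype B] [DecidableEq B]
    (Φ Ψ : ℝ → Matrix A A ℂ →ₗ[ℂ] Matrix B B ℂ) :
    BddAbove (Set.range fun θ => purifiedDist (Φ θ) (Ψ θ)) :=
  ⟨1, by rintro _ ⟨θ, rfl⟩; exact sqrt_one_sub_sq_le_one _⟩

lemma bddAbove_choiPurifiedDist {A B : Type*} [Fintype A] [DecidableEq A] [Fintype B]
    [DecidableEq B] (Φ Ψ : ℝ → Matrix A A ℂ →ₗ[ℂ] Matrix B B ℂ) :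
    BddAbove (Set.range fun θ => choiPurifiedDist (Φ θ) (Ψ θ)) :=
  ⟨1, by rintro _ ⟨θ, rfl⟩; exact sqrt_one_sub_sq_le_one _⟩

/-- For each `R`, compare both sides with `R ∘ N ∘ E ∘ U_L`: one gap is the covariance violation
seen through `R ∘ N`, the other the recovery error precomposed with `U_L`. -/
lemma gateError_le [Nonempty L] (hHL : HL.IsHermitian) (hHS : HS.IsHermitian) (hE : IsChannel E)
    (hN : IsChannel N) :
    gateError HL HS N E ≤ qecInaccuracy N E + covViolation HL HS E := by
  have : Nonempty {R : Matrix S S ℂ →ₗ[ℂ] Matrix L L ℂ // IsChannel R} := nonempty_channel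
  -- Moving the covariance violation to the left leaves a bare infimum over `R` on the right.
  rw [← sub_le_iff_le_add]
  refine le_ciInf fun R => ?_
  rw [sub_le_iff_le_add]
  refine (ciInf_le ⟨0, ?_⟩ R).trans (ciSup_le fun θ => ?_)
  · rintro _ ⟨R, rfl⟩
    exact Real.iSup_nonneg fun θ => Real.sqrt_nonneg _
  have hUL := isChannel_evolChannel hHL θ
  have hUS := isChannel_evolChannel hHS θ
  have hRN := R.2.comp hN
  calc _ ≤ purifiedDist ((R.1 ∘ₗ N) ∘ₗ (evolChannel HS θ ∘ₗ E))
          ((R.1 ∘ₗ N) ∘ₗ (E ∘ₗ evolChannel HL θ)) +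
        purifiedDist ((R.1 ∘ₗ N ∘ₗ E) ∘ₗ evolChannel HL θ)
          (LinearMap.id ∘ₗ evolChannel HL θ) :=
        purifiedDist_triangle (hRN.comp (hUS.comp hE)) (hRN.comp (hE.comp hUL)) hUL
    _ ≤ purifiedDist (evolChannel HS θ ∘ₗ E) (E ∘ₗ evolChannel HL θ) +
        purifiedDist (R.1 ∘ₗ N ∘ₗ E) LinearMap.id :=
        add_le_add (purifiedDist_comp_left (hUS.comp hE) (hE.comp hUL) hRN)
          (purifiedDist_comp_right hUL)
    _ ≤ _ := by
        rw [add_comm]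
        exact add_le_add le_rfl (le_ciSup (bddAbove_purifiedDist
          (fun θ => evolChannel HS θ ∘ₗ E) (fun θ => E ∘ₗ evolChannel HL θ)) θ)

lemma choiGateError_le [Nonempty L] (hHL : HL.IsHermitian) (hHS : HS.IsHermitian)
    (hE : IsChannel E) (hN : IsChannel N) :
    choiGateError HL HS N E ≤ choiQecInaccuracy N E + choiCovViolation HL HS E := by
  have : Nonempty {R : Matrix S S ℂ →ₗ[ℂ] Matrix L L ℂ // IsChannel R} := nonempty_channel
  rw [← sub_le_iff_le_add]
  refine le_ciInf fun R => ?_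
  rw [sub_le_iff_le_add]
  refine (ciInf_le ⟨0, ?_⟩ R).trans (ciSup_le fun θ => ?_)
  · rintro _ ⟨R, rfl⟩
    exact Real.iSup_nonneg fun θ => Real.sqrt_nonneg _
  have hUL := isChannel_evolChannel hHL θ
  have hUS := isChannel_evolChannel hHS θ
  have hRN := R.2.comp hN
  calc _ ≤ choiPurifiedDist ((R.1 ∘ₗ N) ∘ₗ (evolChannel HS θ ∘ₗ E))
          ((R.1 ∘ₗ N) ∘ₗ (E ∘ₗ evolChannel HL θ)) +
        choiPurifiedDist ((R.1 ∘ₗ N ∘ₗ E) ∘ₗ evolChannel HL θ)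
          (LinearMap.id ∘ₗ evolChannel HL θ) :=
        choiPurifiedDist_triangle (hRN.comp (hUS.comp hE)) (hRN.comp (hE.comp hUL)) hUL
    _ ≤ choiPurifiedDist (evolChannel HS θ ∘ₗ E) (E ∘ₗ evolChannel HL θ) +
        choiPurifiedDist (R.1 ∘ₗ N ∘ₗ E) LinearMap.id :=
        add_le_add (choiPurifiedDist_comp_left (hUS.comp hE) (hE.comp hUL) hRN)
          (choiPurifiedDist_comp_conjMap (hRN.comp hE) isChannel_id
            (evol_conjTranspose_mul hHL θ))
    _ ≤ _ := by
        rw [add_comm]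
        exact add_le_add le_rfl (le_ciSup (bddAbove_choiPurifiedDist
          (fun θ => evolChannel HS θ ∘ₗ E) (fun θ => E ∘ₗ evolChannel HL θ)) θ)

end Upper

/-! ### Positive semidefinite quadratic forms -/

section Quadratic

variable {n : Type*} [Fintype n]

lemma _root_.Matrix.PosSemidef.re_dotProduct_mulVec_nonneg' {A : Matrix n n ℂ} (hA : A.PosSemidef)
    (v : n → ℂ) : 0 ≤ (star v ⬝ᵥ A *ᵥ v).re :=
  (Complex.le_def.mp (hA.dotProduct_mulVec_nonneg v)).1

lemma re_dotProduct_mulVec_comm {A : Matrix n n ℂ} (hA : A.IsHermitian) (v w : n → ℂ) :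
    (star w ⬝ᵥ A *ᵥ v).re = (star v ⬝ᵥ A *ᵥ w).re := by
  rw [← Complex.conj_re (star v ⬝ᵥ A *ᵥ w), ← Complex.star_def, ← star_dotProduct_star, star_star,
    star_mulVec, hA.eq, ← dotProduct_mulVec]

/-- The Cauchy-Schwarz inequality for a positive semidefinite form. -/
lemma re_dotProduct_mulVec_sq_le {A : Matrix n n ℂ} (hA : A.PosSemidef) (v w : n → ℂ) :
    (star v ⬝ᵥ A *ᵥ w).re ^ 2 ≤ (star v ⬝ᵥ A *ᵥ v).re * (star w ⬝ᵥ A *ᵥ w).re := by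
  have h : ∀ t : ℝ, 0 ≤ (star w ⬝ᵥ A *ᵥ w).re * (t * t) + (2 * (star v ⬝ᵥ A *ᵥ w).re) * t
      + (star v ⬝ᵥ A *ᵥ v).re := by
    intro t
    have := hA.re_dotProduct_mulVec_nonneg' (v + (t : ℂ) • w)
    simp only [star_add, star_smul, mulVec_add, mulVec_smul, dotProduct_add, add_dotProduct,
      smul_dotProduct, dotProduct_smul, Complex.star_def, Complex.conj_ofReal, smul_eq_mul,
      Complex.add_re, Complex.re_ofReal_mul, re_dotProduct_mulVec_comm hA.isHermitian v w] at this
    linarith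
  have := discrim_le_zero h
  rw [discrim] at this
  nlinarith

variable [DecidableEq n]

/-- `D = ‖v‖² - v vᴴ` satisfies `D² = ‖v‖² D`, so it is a nonnegative multiple of `D Dᴴ`. -/
lemma smul_one_sub_vecMulVec_posSemidef (v : n → ℂ) :
    ((star v ⬝ᵥ v) • (1 : Matrix n n ℂ) - vecMulVec v (star v)).PosSemidef := by
  have hs : 0 ≤ star v ⬝ᵥ v := dotProduct_star_self_nonneg v
  rcases eq_or_ne (star v ⬝ᵥ v) 0 with h | h
  · have hv : v = 0 := dotProduct_star_self_eq_zero.mp h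
    subst hv
    simpa using PosSemidef.zero
  · set s := star v ⬝ᵥ v with hsdef
    set D := s • (1 : Matrix n n ℂ) - vecMulVec v (star v) with hD
    have hherm : Dᴴ = D := by
      rw [hD, conjTranspose_sub, conjTranspose_smul, conjTranspose_one,
        (posSemidef_vecMulVec_self_star v).isHermitian.eq, (IsSelfAdjoint.of_nonneg hs).star_eq]
    have e : D = s⁻¹ • (D * Dᴴ) := by
      rw [hherm]
      have : D * D = s • D := by
        nth_rewrite 2 [hD]
        rw [Matrix.mul_sub, Matrix.mul_smul, Matrix.mul_one, hD, Matrix.sub_mul, Matrix.smul_mul,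
          Matrix.one_mul, vecMulVec_mul_vecMulVec, ← hsdef]
        simp [vecMulVec_smul]
      rw [this, smul_smul, inv_mul_cancel₀ h, one_smul]
    rw [e]
    exact (posSemidef_self_mul_conjTranspose D).smul (inv_nonneg.mpr hs)

lemma trace_mul_vecMulVec (A : Matrix n n ℂ) (v : n → ℂ) :
    (A * vecMulVec v (star v)).trace = star v ⬝ᵥ A *ᵥ v := by
  rw [mul_vecMulVec, trace_vecMulVec, dotProduct_comm]

lemma re_dotProduct_mulVec_le_trace {A : Matrix n n ℂ} (hA : A.PosSemidef) {v : n → ℂ}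
    (hv : star v ⬝ᵥ v = 1) : (star v ⬝ᵥ A *ᵥ v).re ≤ A.trace.re := by
  have h := re_trace_mul_nonneg hA (smul_one_sub_vecMulVec_posSemidef v)
  rw [hv, one_smul, Matrix.mul_sub, Matrix.mul_one, trace_sub, trace_mul_vecMulVec,
    Complex.sub_re] at h
  linarith

/-- On the complement of `v` the form is bounded by the trace left there. For a state with overlap
at least `1 - y²` with `v`, this leaves weight at most `y²`. -/
lemma re_dotProduct_mulVec_le_of_orthogonal {A : Matrix n n ℂ} (hA : A.PosSemidef) {v w : n → ℂ}
    (hv : star v ⬝ᵥ v = 1) (hvw : star v ⬝ᵥ w = 0) :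
    (star w ⬝ᵥ A *ᵥ w).re ≤ (star w ⬝ᵥ w).re * (A.trace.re - (star v ⬝ᵥ A *ᵥ v).re) := by
  set P := (1 : Matrix n n ℂ) - vecMulVec v (star v) with hP
  have hPh : Pᴴ = P := by
    rw [hP, conjTranspose_sub, conjTranspose_one,
      (posSemidef_vecMulVec_self_star v).isHermitian.eq]
  have hPP : P * P = P := by
    simp [hP, Matrix.mul_sub, Matrix.sub_mul, vecMulVec_mul_vecMulVec, hv]
  have hPw : P *ᵥ w = w := by
    rw [hP, sub_mulVec, vecMulVec_mulVec, hvw]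
    simp
  have h1 := (smul_one_sub_vecMulVec_posSemidef w).mul_mul_conjTranspose_same P
  rw [Matrix.mul_sub, Matrix.sub_mul, mul_vecMulVec_star_mul, hPw, hPh, Matrix.mul_smul,
    Matrix.smul_mul, Matrix.mul_one, hPP] at h1
  have h2 := re_trace_mul_nonneg hA h1
  have him : (star w ⬝ᵥ w).im = 0 :=
    (Complex.le_def.mp (dotProduct_star_self_nonneg w)).2.symm
  rw [Matrix.mul_sub, trace_sub, trace_mul_vecMulVec, Matrix.mul_smul, trace_smul, hP,
    Matrix.mul_sub, trace_sub, trace_mul_vecMulVec, Matrix.mul_one, Complex.sub_re, smul_eq_mul,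
    Complex.mul_re, him, Complex.sub_re] at h2
  linarith

end Quadratic

/-! ### Entrywise derivatives of matrix curves -/

section Deriv

variable {A B C R : Type*} [Fintype A] [Fintype B]

/-- The matrix curve `M` has the entrywise derivative `M'` at `θ`. -/
def HasMatDerivAt {A B : Type*} (M : ℝ → Matrix A B ℂ) (M' : Matrix A B ℂ) (θ : ℝ) : Prop :=
  ∀ i j, HasDerivAt (fun t => M t i j) (M' i j) θ

lemma HasMatDerivAt.matDeriv_eq {M : ℝ → Matrix A A ℂ} {M' : Matrix A A ℂ} {θ : ℝ}
    (h : HasMatDerivAt M M' θ) : matDeriv M θ = M' := by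
  ext i j
  exact (h i j).deriv

lemma HasMatDerivAt.mul {M : ℝ → Matrix C A ℂ} {M' : Matrix C A ℂ} {N : ℝ → Matrix A R ℂ}
    {N' : Matrix A R ℂ} {θ : ℝ} (hM : HasMatDerivAt M M' θ) (hN : HasMatDerivAt N N' θ) :
    HasMatDerivAt (fun t => M t * N t) (M' * N θ + M θ * N') θ := by
  intro i j
  simp only [Matrix.mul_apply, Matrix.add_apply, ← Finset.sum_add_distrib]
  exact HasDerivAt.fun_sum fun k _ => (hM i k).mul (hN k j)

lemma hasMatDerivAt_const (M : Matrix A B ℂ) (θ : ℝ) : HasMatDerivAt (fun _ => M) 0 θ :=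
  fun _ _ => hasDerivAt_const _ _

lemma HasMatDerivAt.conjTranspose {M : ℝ → Matrix A B ℂ} {M' : Matrix A B ℂ} {θ : ℝ}
    (h : HasMatDerivAt M M' θ) : HasMatDerivAt (fun t => (M t)ᴴ) M'ᴴ θ :=
  fun i j => (h j i).star

lemma HasMatDerivAt.isHermitian {M : ℝ → Matrix A A ℂ} {M' : Matrix A A ℂ} {θ : ℝ}
    (h : HasMatDerivAt M M' θ) (hM : ∀ t, (M t).IsHermitian) : M'.IsHermitian := by
  ext i j
  have := h.conjTranspose i j
  simp only [fun t => (hM t).eq] at this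
  exact this.unique (h i j)

lemma HasMatDerivAt.linearMap {M : ℝ → Matrix A A ℂ} {M' : Matrix A A ℂ} {θ : ℝ}
    (h : HasMatDerivAt M M' θ) (Φ : Matrix A A ℂ →ₗ[ℂ] Matrix B B ℂ) :
    HasMatDerivAt (fun t => Φ (M t)) (Φ M') θ := by
  classical
  have e : ∀ X : Matrix A A ℂ, ∀ i j,
      Φ X i j = ∑ a, ∑ a', X a a' * Φ (Matrix.single a a' 1) i j := by
    intro X i j
    conv_lhs => rw [matrix_eq_sum_single X]
    simp only [map_sum, Matrix.sum_apply]
    refine Finset.sum_congr rfl fun a _ => Finset.sum_congr rfl fun a' _ => ?_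
    rw [show Matrix.single a a' (X a a') = X a a' • Matrix.single a a' (1 : ℂ) by simp, map_smul]
    rfl
  intro i j
  rw [e M' i j, show (fun t => Φ (M t) i j) = _ from funext fun t => e (M t) i j]
  exact HasDerivAt.fun_sum fun a _ => HasDerivAt.fun_sum fun a' _ => (h a a').mul_const _

lemma HasMatDerivAt.ampl {M : ℝ → Matrix (A × R) (A × R) ℂ} {M' : Matrix (A × R) (A × R) ℂ}
    {θ : ℝ} (h : HasMatDerivAt M M' θ) (Φ : Matrix A A ℂ →ₗ[ℂ] Matrix B B ℂ) :
    HasMatDerivAt (fun t => ampl R Φ (M t)) (ampl R Φ M') θ := by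
  rintro ⟨b, r⟩ ⟨b', r'⟩
  have h' : HasMatDerivAt (fun t => Matrix.of fun a a' => M t (a, r) (a', r'))
      (Matrix.of fun a a' => M' (a, r) (a', r')) θ := fun a a' => h (a, r) (a', r')
  exact h'.linearMap Φ b b'

lemma HasMatDerivAt.dotProduct_mulVec {M : ℝ → Matrix A B ℂ} {M' : Matrix A B ℂ} {θ : ℝ}
    (h : HasMatDerivAt M M' θ) (v : A → ℂ) (w : B → ℂ) :
    HasDerivAt (fun t => v ⬝ᵥ M t *ᵥ w) (v ⬝ᵥ M' *ᵥ w) θ := by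
  simp only [dotProduct, mulVec]
  exact HasDerivAt.fun_sum fun a _ => (HasDerivAt.fun_sum fun b _ =>
    (h a b).mul_const _).const_mul _

lemma HasMatDerivAt.kronecker_one [DecidableEq R] {M : ℝ → Matrix A B ℂ} {M' : Matrix A B ℂ}
    {θ : ℝ} (h : HasMatDerivAt M M' θ) :
    HasMatDerivAt (fun t => M t ⊗ₖ (1 : Matrix R R ℂ)) (M' ⊗ₖ (1 : Matrix R R ℂ)) θ :=
  fun i j => (h i.1 j.1).mul_const _

section

attribute [local instance] Matrix.linftyOpNormedRing Matrix.linftyOpNormedAlgebra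

/-- The matrix norm is only local, to differentiate the exponential; a continuous entry functional
carries the derivative to entries. -/
lemma hasMatDerivAt_evol [DecidableEq A] (H : Matrix A A ℂ) (θ : ℝ) :
    HasMatDerivAt (evol H) (-Complex.I • (evol H θ * H)) θ := by
  intro i j
  have e : ∀ t : ℝ, evol H t = NormedSpace.exp (t • (-Complex.I • H)) := by
    intro t
    rw [evol, ← Complex.coe_smul, smul_smul]
    congr 2
    ring
  have h := hasDerivAt_exp_smul_const (𝕂 := ℝ) (-Complex.I • H) θ
  let l : Matrix A A ℂ →L[ℝ] ℂ := LinearMap.toContinuousLinearMap (Matrix.entryLinearMap ℝ ℂ i j)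
  have h' := l.hasFDerivAt.comp_hasDerivAt θ h
  have hd : l (NormedSpace.exp (θ • (-Complex.I • H)) * (-Complex.I • H)) =
      (-Complex.I • (evol H θ * H)) i j := by
    rw [e, ← Matrix.mul_smul]
    rfl
  rw [← hd, show (fun t => evol H t i j) = _ from funext fun t => congrFun₂ (e t) i j]
  exact h'

end

end Deriv

/-! ### Block form of the RLD Fisher information -/

section Rld

variable {A B R : Type*} [Fintype A] [DecidableEq A] [Fintype B] [DecidableEq B] [Fintype R]
  [DecidableEq R]

/-- The witness is `W = D ρ⁻¹ D`, as for a Schur complement. The block form trades the inverse on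
the support, which channels do not respect, for a positivity statement, which they do. -/
lemma exists_block_of_rldState {ρ : ℝ → Matrix A A ℂ} {D : Matrix A A ℂ} {θ : ℝ}
    (hρ : ∀ t, (ρ t).PosSemidef) (hD : HasMatDerivAt ρ D θ) {F : ℝ≥0∞} (hF : F ≠ ∞)
    (h : rldState ρ θ ≤ F) :
    ∃ W : Matrix A A ℂ, (fromBlocks (ρ θ) D D W).PosSemidef ∧ W.trace.re ≤ F.toReal := by
  have hDh := hD.isHermitian fun t => (hρ t).isHermitian
  have hI := supportInv_isHermitian (ρ θ)
  have hρh := (hρ θ).isHermitian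
  rw [rldState, hD.matDeriv_eq] at h
  split_ifs at h with hker
  swap
  · exact absurd (top_le_iff.mp h) hF
  -- The columns of `1 - ρ⁻¹ ρ` lie in the kernel of `ρ`, hence in that of `D`.
  have hsupp : D * (supportInv (ρ θ) * ρ θ) = D := by
    have h0 : D * (1 - supportInv (ρ θ) * ρ θ) = 0 := by
      ext i j
      have hz : ρ θ * (1 - supportInv (ρ θ) * ρ θ) = 0 := by
        rw [Matrix.mul_sub, Matrix.mul_one, ← Matrix.mul_assoc, mul_supportInv_mul hρh, sub_self]
      have := hker (fun k => (1 - supportInv (ρ θ) * ρ θ) k j) (by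
        ext k; exact congrFun₂ hz k j)
      exact congrFun this i
    rw [Matrix.mul_sub, Matrix.mul_one, sub_eq_zero] at h0
    exact h0.symm
  have hsupp' : ρ θ * supportInv (ρ θ) * D = D := by
    simpa [conjTranspose_mul, hI.eq, hρh.eq, hDh.eq] using congrArg Matrix.conjTranspose hsupp
  refine ⟨D * supportInv (ρ θ) * D, ?_, ?_⟩
  · have := (fromBlocks_diagonal_posSemidef (hρ θ) (PosSemidef.zero (n := A) (R := ℂ))
      ).mul_mul_conjTranspose_same (fromBlocks (1 : Matrix A A ℂ) (0 : Matrix A A ℂ)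
        (D * supportInv (ρ θ)) (0 : Matrix A A ℂ))
    simp only [fromBlocks_conjTranspose, fromBlocks_multiply, Matrix.mul_zero,
      add_zero, conjTranspose_zero, conjTranspose_one, Matrix.mul_one,
      Matrix.one_mul, conjTranspose_mul, hI.eq, hDh.eq] at this
    rwa [← Matrix.mul_assoc, hsupp', Matrix.mul_assoc D, hsupp, ← Matrix.mul_assoc] at this
  · rw [ENNReal.ofReal_le_iff_le_toReal hF] at h
    rwa [trace_mul_comm, ← Matrix.mul_assoc]

/-- The supremum in `rldChannel` uses references `Fin n`; a general reference is relabelled and the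
block transported back. -/
lemma exists_block_of_rldChannel {Φ : ℝ → Matrix A A ℂ →ₗ[ℂ] Matrix B B ℂ} {θ : ℝ}
    (hΦ : ∀ t, IsChannel (Φ t)) {X : Matrix (A × R) (A × R) ℂ} (hX : IsState X)
    {D : Matrix (B × R) (B × R) ℂ} (hD : HasMatDerivAt (fun t => ampl R (Φ t) X) D θ)
    (hF : rldChannel Φ θ ≠ ∞) :
    ∃ W : Matrix (B × R) (B × R) ℂ, (fromBlocks (ampl R (Φ θ) X) D D W).PosSemidef ∧
      W.trace.re ≤ (rldChannel Φ θ).toReal := by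
  let e := Fintype.equivFin R
  let eA : A × Fin (Fintype.card R) ≃ A × R := (Equiv.refl A).prodCongr e.symm
  let eB : B × Fin (Fintype.card R) ≃ B × R := (Equiv.refl B).prodCongr e.symm
  have hX' : IsState (X.submatrix eA eA) :=
    ⟨hX.1.submatrix _, by rw [← hX.2]; exact eA.sum_comp fun i => X i i⟩
  have hle : rldState (fun t => ampl (Fin (Fintype.card R)) (Φ t) (X.submatrix eA eA)) θ ≤
      rldChannel Φ θ :=
    le_iSup₂_of_le (Fintype.card R) ⟨X.submatrix eA eA, hX'⟩ le_rfl
  have hD' : HasMatDerivAt (fun t => ampl (Fin (Fintype.card R)) (Φ t) (X.submatrix eA eA))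
      (D.submatrix eB eB) θ := fun i j => hD (eB i) (eB j)
  obtain ⟨W, hW, hWF⟩ := exists_block_of_rldState
    (fun t => ((hΦ t).isState_ampl hX').1) hD' hF hle
  refine ⟨W.submatrix eB.symm eB.symm, ?_, ?_⟩
  · have := hW.submatrix (Equiv.sumCongr eB.symm eB.symm)
    convert this using 1
    ext (i | i) (j | j)
    · change _ = ampl R (Φ θ) X (eB (eB.symm i)) (eB (eB.symm j))
      simp
    · simp
    · simp
    · simp
  · rwa [show (W.submatrix eB.symm eB.symm).trace = W.trace from
      eB.symm.sum_comp fun i => W i i]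

end Rld

/-! ### A Fisher-information bound for nearly unitary periodic curves -/

section Core

variable {n : Type*} [Fintype n] [DecidableEq n]

/-- The Cauchy-Schwarz inequality for the off-diagonal block of a positive matrix. -/
lemma re_offDiagonal_sq_le {A B W : Matrix n n ℂ} (h : (fromBlocks A B B W).PosSemidef)
    (v w : n → ℂ) : (star v ⬝ᵥ B *ᵥ w).re ^ 2 ≤
      (star v ⬝ᵥ A *ᵥ v).re * (star w ⬝ᵥ W *ᵥ w).re := by
  have := re_dotProduct_mulVec_sq_le h (Sum.elim v 0) (Sum.elim 0 w)
  have hs : ∀ a b : n → ℂ, star (Sum.elim a b) = Sum.elim (star a) (star b) := by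
    intro a b; ext (i | i) <;> rfl
  simpa [fromBlocks_mulVec, hs, Sum.elim_comp_inl, Sum.elim_comp_inr] using this

/-- Everything is in the co-moving frame: `A` is the rotated state, `B` the rotated derivative, and
`hstat` the stationarity of `Re (i⟨u|A|ψ⟩)`. Stationarity equates `Re⟨u|B|iψ⟩` with a commutator
term of size at least `κ (1 - 2 y²) - ξ y`. The block bounds its square by `⟨u|A|u⟩ Tr W`, and
`⟨u|A|u⟩ ≤ y²` because `u ⊥ ψ`. -/
lemma fisher_bound_pointwise {K A B W : Matrix n n ℂ} (hK : K.IsHermitian)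
    (hblock : (fromBlocks A B B W).PosSemidef) (hA : IsState A) {F y ξ κ m : ℝ}
    (hW : W.trace.re ≤ F) (hy : 0 ≤ y) (hξ : 0 ≤ ξ) (hκ : 0 ≤ κ) {ψ u x : n → ℂ}
    (hψ : star ψ ⬝ᵥ ψ = 1) (hu : star u ⬝ᵥ u = 1) (hψu : star ψ ⬝ᵥ u = 0)
    (hψx : star ψ ⬝ᵥ x = 0) (hx : (star x ⬝ᵥ x).re ≤ ξ ^ 2)
    (hKψ : K *ᵥ ψ = (m : ℂ) • ψ + (κ : ℂ) • u)
    (hKu : K *ᵥ u = (m : ℂ) • u + (κ : ℂ) • ψ + x)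
    (ha : 1 - y ^ 2 ≤ (star ψ ⬝ᵥ A *ᵥ ψ).re)
    (hstat : (Complex.I * (star u ⬝ᵥ (Complex.I • (K * A) + B - Complex.I • (A * K)) *ᵥ ψ)).re = 0)
    (hc : 0 ≤ κ * (1 - 2 * y ^ 2) - ξ * y) :
    (κ * (1 - 2 * y ^ 2) - ξ * y) ^ 2 ≤ y ^ 2 * F := by
  have hAtr : A.trace.re = 1 := by rw [hA.2]; rfl
  have hWp : W.PosSemidef := hblock.submatrix Sum.inr
  set a := (star ψ ⬝ᵥ A *ᵥ ψ).re with ha_def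
  set b := (star u ⬝ᵥ A *ᵥ u).re with hb_def
  have ha1 : a ≤ 1 := hAtr ▸ re_dotProduct_mulVec_le_trace hA.1 hψ
  have ha0 : 0 ≤ a := hA.1.re_dotProduct_mulVec_nonneg' ψ
  have hb0 : 0 ≤ b := hA.1.re_dotProduct_mulVec_nonneg' u
  have hb : b ≤ y ^ 2 := by
    have := re_dotProduct_mulVec_le_of_orthogonal hA.1 hψ hψu
    rw [hu, Complex.one_re, hAtr] at this
    linarith
  have hxA : (star x ⬝ᵥ A *ᵥ x).re ≤ ξ ^ 2 * y ^ 2 := by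
    refine (re_dotProduct_mulVec_le_of_orthogonal hA.1 hψ hψx).trans ?_
    rw [hAtr]
    exact mul_le_mul hx (by linarith) (by linarith) (sq_nonneg _)
  -- Cauchy-Schwarz for the form `A`: the residual `x ⊥ ψ` contributes at most `ξ² y²`, and `ψ` at
  -- most `1`.
  have hxψ : -(ξ * y) ≤ (star x ⬝ᵥ A *ᵥ ψ).re := by
    have h1 := re_dotProduct_mulVec_sq_le hA.1 x ψ
    have h2 : (star x ⬝ᵥ A *ᵥ ψ).re ^ 2 ≤ (ξ * y) ^ 2 := by
      have := hA.1.re_dotProduct_mulVec_nonneg' x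
      nlinarith
    exact (abs_le_of_sq_le_sq' h2 (by positivity)).1
  -- The mean `m` cancels between `K A` and `A K`.
  have hq : (star u ⬝ᵥ B *ᵥ (Complex.I • ψ)).re =
      κ * (a - b) + (star x ⬝ᵥ A *ᵥ ψ).re := by
    have e1 : star u ⬝ᵥ (K * A) *ᵥ ψ = (m : ℂ) * (star u ⬝ᵥ A *ᵥ ψ)
        + (κ : ℂ) * (star ψ ⬝ᵥ A *ᵥ ψ) + star x ⬝ᵥ A *ᵥ ψ := by
      rw [← mulVec_mulVec, dotProduct_mulVec, ← hK.eq, ← star_mulVec, hKu]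
      simp [add_dotProduct, smul_dotProduct]
    have e2 : star u ⬝ᵥ (A * K) *ᵥ ψ = (m : ℂ) * (star u ⬝ᵥ A *ᵥ ψ)
        + (κ : ℂ) * (star u ⬝ᵥ A *ᵥ u) := by
      rw [← mulVec_mulVec, hKψ]
      simp [mulVec_add, mulVec_smul, dotProduct_add, dotProduct_smul]
    rw [sub_mulVec, add_mulVec, smul_mulVec, smul_mulVec, dotProduct_sub, dotProduct_add,
      dotProduct_smul, dotProduct_smul, e1, e2] at hstat
    rw [mulVec_smul, dotProduct_smul]
    simp [Complex.add_re, Complex.sub_re, Complex.mul_re, Complex.mul_im] at hstat ⊢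
    linarith
  have hqc : κ * (1 - 2 * y ^ 2) - ξ * y ≤ (star u ⬝ᵥ B *ᵥ (Complex.I • ψ)).re := by
    rw [hq]
    have : κ * (1 - 2 * y ^ 2) ≤ κ * (a - b) := mul_le_mul_of_nonneg_left (by linarith) hκ
    linarith
  have hIψ : star (Complex.I • ψ) ⬝ᵥ (Complex.I • ψ) = 1 := by
    rw [star_smul, smul_dotProduct, dotProduct_smul, hψ]
    simp
  have hWψ := (re_dotProduct_mulVec_le_trace hWp hIψ).trans hW
  calc (κ * (1 - 2 * y ^ 2) - ξ * y) ^ 2 ≤ (star u ⬝ᵥ B *ᵥ (Complex.I • ψ)).re ^ 2 :=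
        pow_le_pow_left₀ hc hqc 2
    _ ≤ b * (star (Complex.I • ψ) ⬝ᵥ W *ᵥ (Complex.I • ψ)).re := re_offDiagonal_sq_le hblock _ _
    _ ≤ y ^ 2 * F := mul_le_mul hb hWψ (hWp.re_dotProduct_mulVec_nonneg' _) (sq_nonneg _)

/-- If a periodic curve of states stays close to the curve of pure states generated by `K`, then
its RLD Fisher information is large at some time. -/
lemma fisher_bound_of_periodic {K : Matrix n n ℂ} {U ρ D W : ℝ → Matrix n n ℂ}
    (hK : K.IsHermitian) (hU : ∀ t, (U t)ᴴ * U t = 1)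
    (hU' : ∀ t, HasMatDerivAt U (-Complex.I • (U t * K)) t)
    (hρ : ∀ t, IsState (ρ t)) (hρ' : ∀ t, HasMatDerivAt ρ (D t) t) {τ : ℝ} (hτ : 0 < τ)
    (hUτ : U τ = U 0) (hρτ : ρ τ = ρ 0)
    (hblock : ∀ t, (fromBlocks (ρ t) (D t) (D t) (W t)).PosSemidef) {F y ξ κ m : ℝ}
    (hW : ∀ t, (W t).trace.re ≤ F) (hy : 0 ≤ y) (hξ : 0 ≤ ξ) (hκ : 0 ≤ κ) {ψ u x : n → ℂ}
    (hψ : star ψ ⬝ᵥ ψ = 1) (hu : star u ⬝ᵥ u = 1) (hψu : star ψ ⬝ᵥ u = 0)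
    (hψx : star ψ ⬝ᵥ x = 0) (hx : (star x ⬝ᵥ x).re ≤ ξ ^ 2)
    (hKψ : K *ᵥ ψ = (m : ℂ) • ψ + (κ : ℂ) • u)
    (hKu : K *ᵥ u = (m : ℂ) • u + (κ : ℂ) • ψ + x)
    (ha : ∀ t, 1 - y ^ 2 ≤ (star (U t *ᵥ ψ) ⬝ᵥ ρ t *ᵥ (U t *ᵥ ψ)).re)
    (hc : 0 ≤ κ * (1 - 2 * y ^ 2) - ξ * y) :
    (κ * (1 - 2 * y ^ 2) - ξ * y) ^ 2 ≤ y ^ 2 * F := by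
  -- The state in the frame co-moving with `U`; its derivative is the rotated `D` plus `i [K, M]`.
  let M : ℝ → Matrix n n ℂ := fun t => (U t)ᴴ * ρ t * U t
  have hM : ∀ t, HasMatDerivAt M (Complex.I • (K * M t) + (U t)ᴴ * D t * U t
      - Complex.I • (M t * K)) t := by
    intro t
    convert ((hU' t).conjTranspose.mul (hρ' t)).mul (hU' t) using 1
    simp only [M, conjTranspose_smul, conjTranspose_mul, hK.eq, Matrix.add_mul, Matrix.mul_smul,
      Matrix.smul_mul, star_neg, Complex.star_def, Complex.conj_I, neg_neg, Matrix.mul_assoc,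
      sub_eq_add_neg]
    rw [neg_smul]
  have hs : ∀ t, HasDerivAt (fun t => (Complex.I * (star u ⬝ᵥ M t *ᵥ ψ)).re)
      (Complex.I * (star u ⬝ᵥ (Complex.I • (K * M t) + (U t)ᴴ * D t * U t
        - Complex.I • (M t * K)) *ᵥ ψ)).re t := fun t =>
    Complex.reCLM.hasFDerivAt.comp_hasDerivAt t
      (((hM t).dotProduct_mulVec (star u) ψ).const_mul Complex.I)
  -- Rolle: periodicity of `U` and `ρ` gives equal values at `0` and `τ`.
  obtain ⟨t, -, ht⟩ := exists_deriv_eq_zero hτ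
    (fun t _ => (hs t).continuousAt.continuousWithinAt) (by simp only [M, hUτ, hρτ])
  rw [(hs t).deriv] at ht
  have hUU : U t * (U t)ᴴ = 1 := mul_eq_one_comm.mp (hU t)
  have hb := (hblock t).conjTranspose_mul_mul_same (fromBlocks (U t) 0 0 (U t))
  simp only [fromBlocks_conjTranspose, fromBlocks_multiply, Matrix.zero_mul, Matrix.mul_zero,
    add_zero, zero_add, conjTranspose_zero] at hb
  have htr : ∀ Z : Matrix n n ℂ, ((U t)ᴴ * Z * U t).trace = Z.trace := by
    intro Z
    rw [trace_mul_comm, ← Matrix.mul_assoc, hUU, Matrix.one_mul]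
  refine fisher_bound_pointwise hK hb ⟨(hρ t).1.conjTranspose_mul_mul_same _, ?_⟩ ?_ hy hξ hκ
    hψ hu hψu hψx hx hKψ hKu ?_ ht hc
  · rw [htr, (hρ t).2]
  · rw [htr]
    exact hW t
  · have := ha t
    rwa [star_mulVec, ← dotProduct_mulVec, mulVec_mulVec, mulVec_mulVec] at this

end Core

/-! ### Fisher information of a noisy gate that can be recovered -/

section Gate

variable {L S : Type*} [Fintype L] [DecidableEq L] [Fintype S] [DecidableEq S]

lemma evolChannel_add (H : Matrix L L ℂ) (s t : ℝ) :
    evolChannel H (s + t) = evolChannel H s ∘ₗ evolChannel H t := by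
  refine LinearMap.ext fun X => ?_
  change evol H (s + t) * X * (evol H (s + t))ᴴ =
    evol H s * (evol H t * X * (evol H t)ᴴ) * (evol H s)ᴴ
  rw [evol_add, conjTranspose_mul]
  simp only [Matrix.mul_assoc]

lemma exists_hasMatDerivAt_ampl_noisyGate {R : Type*} [Fintype R] [DecidableEq R]
    (N : Matrix S S ℂ →ₗ[ℂ] Matrix S S ℂ) (H : Matrix S S ℂ) (X : Matrix (S × R) (S × R) ℂ)
    (t : ℝ) : ∃ D, HasMatDerivAt (fun t => ampl R (noisyGate N H t) X) D t := by
  have hU := (hasMatDerivAt_evol H t).kronecker_one (R := R)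
  have h := ((hU.mul (hasMatDerivAt_const X t)).mul hU.conjTranspose).ampl N
  simp only [← ampl_conjMap] at h
  exact ⟨_, h⟩

variable {HL : Matrix L L ℂ} {HS : Matrix S S ℂ} {E : Matrix L L ℂ →ₗ[ℂ] Matrix S S ℂ}
  {N : Matrix S S ℂ →ₗ[ℂ] Matrix S S ℂ} {R : Matrix S S ℂ →ₗ[ℂ] Matrix L L ℂ}

/-- The information at the single time `θ₀` controls all times, because a shift in time is a
rotation of the input and `rldChannel` is a supremum over inputs. `R` is independent of time, so it
may be applied to the curve, its derivative and the block together. -/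
lemma rldChannel_noisyGate_bound (hHL : HL.IsHermitian) (hHS : HS.IsHermitian) {τ : ℝ}
    (hτ : 0 < τ) (hLτ : ∀ θ, evol HL (θ + τ) = evol HL θ)
    (hSτ : ∀ θ, evol HS (θ + τ) = evol HS θ) (hE : IsChannel E) (hN : IsChannel N)
    (hR : IsChannel R) {ψ u x : L × L → ℂ} {m κ ξ y : ℝ} (hy : 0 ≤ y) (hξ : 0 ≤ ξ) (hκ : 0 ≤ κ)
    (hψ : star ψ ⬝ᵥ ψ = 1) (hu : star u ⬝ᵥ u = 1) (hψu : star ψ ⬝ᵥ u = 0)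
    (hψx : star ψ ⬝ᵥ x = 0) (hx : (star x ⬝ᵥ x).re ≤ ξ ^ 2)
    (hKψ : (HL ⊗ₖ (1 : Matrix L L ℂ)) *ᵥ ψ = (m : ℂ) • ψ + (κ : ℂ) • u)
    (hKu : (HL ⊗ₖ (1 : Matrix L L ℂ)) *ᵥ u = (m : ℂ) • u + (κ : ℂ) • ψ + x)
    (hdist : ∀ θ, √(1 - fidelity (ampl L (R ∘ₗ noisyGate N HS θ ∘ₗ E) (vecMulVec ψ (star ψ)))
      (ampl L (evolChannel HL θ) (vecMulVec ψ (star ψ))) ^ 2) ≤ y)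
    (hc : 0 ≤ κ * (1 - 2 * y ^ 2) - ξ * y) (θ₀ : ℝ)
    (hF : rldChannel (noisyGate N HS) θ₀ ≠ ∞) :
    (κ * (1 - 2 * y ^ 2) - ξ * y) ^ 2 ≤ y ^ 2 * (rldChannel (noisyGate N HS) θ₀).toReal := by
  have hNt : ∀ t, IsChannel (noisyGate N HS t) := fun t => hN.comp (isChannel_evolChannel hHS t)
  have hψs : IsState (vecMulVec ψ (star ψ)) := isState_vecMulVec hψ
  set X := ampl L E (vecMulVec ψ (star ψ)) with hX
  have hXs : IsState X := hE.isState_ampl hψs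
  choose D hD using fun t => exists_hasMatDerivAt_ampl_noisyGate (R := L) N HS X t
  have hW : ∀ t, ∃ W : Matrix (S × L) (S × L) ℂ,
      (fromBlocks (ampl L (noisyGate N HS t) X) (D t) (D t) W).PosSemidef ∧
        W.trace.re ≤ (rldChannel (noisyGate N HS) θ₀).toReal := by
    intro t
    have hshift : ∀ s, ampl L (noisyGate N HS s) (ampl L (evolChannel HS (t - θ₀)) X) =
        ampl L (noisyGate N HS (s + (t - θ₀))) X := by
      intro s
      rw [noisyGate, noisyGate, evolChannel_add]
      rfl
    have ht : θ₀ + (t - θ₀) = t := by ring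
    have hD' : HasMatDerivAt (fun s => ampl L (noisyGate N HS s)
        (ampl L (evolChannel HS (t - θ₀)) X)) (D t) θ₀ := by
      simp only [hshift]
      intro i j
      exact HasDerivAt.comp_add_const θ₀ (t - θ₀) (by rw [ht]; exact hD t i j)
    obtain ⟨W, hW, hWF⟩ := exists_block_of_rldChannel hNt
      ((isChannel_evolChannel hHS (t - θ₀)).isState_ampl hXs) hD' hF
    rw [hshift, ht] at hW
    exact ⟨W, hW, hWF⟩
  choose W hW hWF using hW
  have hUU : ∀ t, (evol HL t ⊗ₖ (1 : Matrix L L ℂ))ᴴ * (evol HL t ⊗ₖ (1 : Matrix L L ℂ)) = 1 := by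
    intro t
    rw [conjTranspose_kronecker, ← mul_kronecker_mul, evol_conjTranspose_mul hHL,
      conjTranspose_one, one_mul, one_kronecker_one]
  have hK : (HL ⊗ₖ (1 : Matrix L L ℂ)).IsHermitian := by
    rw [IsHermitian, conjTranspose_kronecker, hHL.eq, conjTranspose_one]
  refine fisher_bound_of_periodic (U := fun t => evol HL t ⊗ₖ (1 : Matrix L L ℂ))
    (ρ := fun t => ampl L R (ampl L (noisyGate N HS t) X)) (D := fun t => ampl L R (D t))
    (W := fun t => ampl L R (W t)) hK hUU ?_
    (fun t => hR.isState_ampl ((hNt t).isState_ampl hXs)) (fun t => (hD t).ampl R) hτ ?_ ?_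
    (fun t => hR.fromBlocks_posSemidef (hW t)) (fun t => by rw [hR.trace_ampl]; exact hWF t)
    hy hξ hκ hψ hu hψu hψx hx hKψ hKu ?_ hc
  · intro t
    convert (hasMatDerivAt_evol HL t).kronecker_one (R := L) using 1
    rw [smul_kronecker, ← mul_kronecker_mul, one_mul]
  · simpa using congrArg (fun M => M ⊗ₖ (1 : Matrix L L ℂ)) (hLτ 0)
  · have := hSτ 0
    rw [zero_add] at this
    simp only [noisyGate, evolChannel, this]
  -- A distance at most `y` from a pure state means an overlap at least `1 - y²`.
  · intro t
    have h1 := hdist t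
    rw [evolChannel, ampl_conjMap, mul_vecMulVec_star_mul, Real.sqrt_le_left hy] at h1
    have hv : star ((evol HL t ⊗ₖ (1 : Matrix L L ℂ)) *ᵥ ψ) ⬝ᵥ
        ((evol HL t ⊗ₖ (1 : Matrix L L ℂ)) *ᵥ ψ) = 1 := by
      rw [star_mulVec, ← dotProduct_mulVec, mulVec_mulVec, hUU, one_mulVec, hψ]
    have h2 := fidelity_vecMulVec_sq_le
      (ρ := ampl L R (ampl L (noisyGate N HS t) X))
      (hR.isState_ampl ((hNt t).isState_ampl hXs)).1 hv
    have h3 : 1 - fidelity (ampl L R (ampl L (noisyGate N HS t) X))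
      (vecMulVec ((evol HL t ⊗ₖ (1 : Matrix L L ℂ)) *ᵥ ψ)
        (star ((evol HL t ⊗ₖ (1 : Matrix L L ℂ)) *ᵥ ψ))) ^ 2 ≤ y ^ 2 := h1
    linarith

end Gate

/-! ### The bounding functions -/

section Scalar

/-- It suffices to exclude each `y > γ` from the set whose supremum is `inverseOn`. The strict
inequality `γ < y` later supplies an actual recovery with error below `y`, so the minimum over
recoveries need not be attained. -/
lemma inverseOn_le {g : ℝ → ℝ} {b γ : ℝ} {x : ℝ≥0∞} (hγ : 0 ≤ γ)
    (h : ∀ y ∈ Set.Ico 0 b, γ < y → x < ENNReal.ofReal (g y)) : inverseOn g b x ≤ γ := by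
  refine Real.sSup_le (fun y hy => ?_) hγ
  by_contra hlt
  exact absurd hy.2 (not_le.mpr (h y hy.1 (not_le.mp hlt)))

/-- The asymptotics are a sandwich: `y ≤ g y` gives `ell x ≤ x`, and the test point `x - c x²` gives
`ell x ≥ x - c x²`. -/
lemma isIncreasingInverse_div_sqrt {h : ℝ → ℝ} {b c : ℝ} (hb : 0 < b) (hc : 0 < c)
    (hanti : AntitoneOn h (Set.Ico 0 b)) (hpos : ∀ y ∈ Set.Ico 0 b, 0 < h y)
    (hle : ∀ y ∈ Set.Ico 0 b, h y ≤ 1) (hlow : ∀ y ∈ Set.Ico 0 b, 1 - c * y ≤ h y) :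
    IsIncreasingInverse (fun y => y / √(h y)) b (inverseOn (fun y => y / √(h y)) b) := by
  set g : ℝ → ℝ := fun y => y / √(h y) with hg
  have hsq : ∀ y ∈ Set.Ico 0 b, 0 < √(h y) := fun y hy => Real.sqrt_pos.mpr (hpos y hy)
  have hmono : StrictMonoOn g (Set.Ico 0 b) := by
    intro x hx y hy hxy
    exact div_lt_div₀ hxy (Real.sqrt_le_sqrt (hanti hx hy hxy.le)) (hx.1.trans hxy.le)
      (hsq y hy)
  have hge : ∀ y ∈ Set.Ico 0 b, y ≤ g y := fun y hy =>
    le_div_self hy.1 (hsq y hy) (Real.sqrt_le_one.mpr (hle y hy))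
  have hbdd : ∀ x : ℝ≥0∞, BddAbove {y : ℝ | y ∈ Set.Ico 0 b ∧ ENNReal.ofReal (g y) ≤ x} :=
    fun x => ⟨b, fun y hy => hy.1.2.le⟩
  refine ⟨hb, by simp [hg], hmono, ?_, ?_⟩
  · intro y hy
    have hgy : 0 ≤ g y := hy.1.trans (hge y hy)
    refine IsGreatest.csSup_eq ⟨⟨hy, le_rfl⟩, fun z hz => ?_⟩
    exact (hmono.le_iff_le hz.1 hy).mp ((ENNReal.ofReal_le_ofReal_iff hgy).mp hz.2)
  · refine Asymptotics.IsBigO.of_bound c ?_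
    have hδ : 0 < min b (1 / c) := lt_min hb (by positivity)
    filter_upwards [Ico_mem_nhdsGE hδ] with x hx
    have hxb : x < b := hx.2.trans_le (min_le_left _ _)
    have hxc : c * x < 1 := by
      have := hx.2.trans_le (min_le_right _ _)
      rwa [lt_div_iff₀ hc, mul_comm] at this
    have hx0 := hx.1
    have hup : inverseOn g b (ENNReal.ofReal x) ≤ x := by
      refine Real.sSup_le (fun y hy => ?_) hx0
      exact (hge y hy.1).trans ((ENNReal.ofReal_le_ofReal_iff hx0).mp hy.2)
    have hlo : x - c * x ^ 2 ≤ inverseOn g b (ENNReal.ofReal x) := by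
      have hy0 : 0 ≤ x - c * x ^ 2 := by nlinarith
      have hyx : x - c * x ^ 2 ≤ x := by nlinarith [sq_nonneg x]
      have hy : x - c * x ^ 2 ∈ Set.Ico 0 b := ⟨hy0, hyx.trans_lt hxb⟩
      refine le_csSup (hbdd _) ⟨hy, ENNReal.ofReal_le_ofReal ?_⟩
      -- Since `0 < h ≤ 1`, the square root dominates `h`, so the linear lower bound on `h` also
      -- bounds `√h`.
      have h1 : h (x - c * x ^ 2) ≤ √(h (x - c * x ^ 2)) :=
        Real.le_sqrt_of_sq_le (by nlinarith [hpos _ hy, hle _ hy])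
      rw [hg, div_le_iff₀ (hsq _ hy)]
      have h2 := hlow _ hy
      have h3 : x * (1 - c * (x - c * x ^ 2)) ≤ x * √(h (x - c * x ^ 2)) :=
        mul_le_mul_of_nonneg_left (h2.trans h1) hx0
      have h4 : c * x * (x - c * x ^ 2) ≤ c * x * x :=
        mul_le_mul_of_nonneg_left hyx (by positivity)
      nlinarith
    rw [Real.norm_eq_abs, Real.norm_eq_abs, abs_of_nonneg (sq_nonneg x), abs_le]
    constructor
    · linarith
    · nlinarith [sq_nonneg x]

lemma eight_lt_six_mul_sqrt_two : 8 < 6 * √2 := by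
  have h : √2 ^ 2 = 2 := Real.sq_sqrt (by norm_num)
  nlinarith [Real.sqrt_nonneg 2]

/-- The common factor `1 - 3 y² + y⁴` is positive and decreasing near `0`. -/
lemma quartic_antitoneOn : AntitoneOn (fun y : ℝ => 1 - 3 * y ^ 2 + y ^ 4) (Set.Icc 0 (1 / 8)) := by
  intro x hx y hy hxy
  have h1 : x ^ 2 ≤ y ^ 2 := pow_le_pow_left₀ hx.1 hxy 2
  have h2 : y ^ 2 ≤ (1 / 8) ^ 2 := pow_le_pow_left₀ hy.1 hy.2 2
  simp only
  nlinarith [sq_nonneg x]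

lemma quartic_bounds {y : ℝ} (hy : y ∈ Set.Icc (0 : ℝ) (1 / 8)) :
    0 < 1 - 3 * y ^ 2 + y ^ 4 ∧ 1 - 3 * y ^ 2 + y ^ 4 ≤ 1 ∧ 1 - 3 * y ≤ 1 - 3 * y ^ 2 + y ^ 4 := by
  have h2 : y ^ 2 ≤ (1 / 8) ^ 2 := pow_le_pow_left₀ hy.1 hy.2 2
  have h3 : y ^ 2 ≤ y := by nlinarith [hy.1, hy.2]
  have h4 : 0 ≤ y ^ 4 := by positivity
  refine ⟨by nlinarith, by nlinarith [sq_nonneg y], by nlinarith⟩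

lemma isIncreasingInverse_of_factor {k : ℝ → ℝ} {b c : ℝ} (hb : 0 < b) (hb8 : b ≤ 1 / 8)
    (hc : 0 ≤ c) (hk : AntitoneOn k (Set.Ico 0 b)) (hpos : ∀ y ∈ Set.Ico 0 b, 0 < k y)
    (hle : ∀ y ∈ Set.Ico 0 b, k y ≤ 1) (hlow : ∀ y ∈ Set.Ico 0 b, 1 - c * y ≤ k y) :
    IsIncreasingInverse (fun y => y / √((1 - 3 * y ^ 2 + y ^ 4) * k y)) b
      (inverseOn (fun y => y / √((1 - 3 * y ^ 2 + y ^ 4) * k y)) b) := by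
  have hsub : Set.Ico 0 b ⊆ Set.Icc 0 (1 / 8) := fun y hy => ⟨hy.1, hy.2.le.trans hb8⟩
  refine isIncreasingInverse_div_sqrt (h := fun y => (1 - 3 * y ^ 2 + y ^ 4) * k y)
    (c := 3 + c) hb (by positivity) ?_ ?_ ?_ ?_
  · intro x hx y hy hxy
    exact mul_le_mul (quartic_antitoneOn (hsub hx) (hsub hy) hxy) (hk hx hy hxy) (hpos y hy).le
      (quartic_bounds (hsub hx)).1.le
  · exact fun y hy => mul_pos (quartic_bounds (hsub hy)).1 (hpos y hy)
  · exact fun y hy => mul_le_one₀ (quartic_bounds (hsub hy)).2.1 (hpos y hy).le (hle y hy)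
  · intro y hy
    obtain ⟨h1, h2, h3⟩ := quartic_bounds (hsub hy)
    have h4 := hle y hy
    have h5 := hlow y hy
    have h6 := hpos y hy
    -- For `p, k ≤ 1` this gives `p k ≥ p + k - 1`, so the slopes `3` and `c` add up.
    have : 0 ≤ (1 - (1 - 3 * y ^ 2 + y ^ 4)) * (1 - k y) :=
      mul_nonneg (by linarith) (by linarith)
    change 1 - (3 + c) * y ≤ (1 - 3 * y ^ 2 + y ^ 4) * k y
    nlinarith

lemma b₂_le : b₂ ≤ 1 / 8 :=
  one_div_le_one_div_of_le (by norm_num) eight_lt_six_mul_sqrt_two.le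

lemma b₂_pos : 0 < b₂ := by unfold b₂; positivity

lemma six_mul_sqrt_two_mul_lt {y : ℝ} (hy : y ∈ Set.Ico 0 b₂) : 6 * √2 * y < 1 := by
  have := hy.2
  rwa [b₂, lt_div_iff₀ (by positivity), mul_comm] at this

lemma g₂_factor_pos {y : ℝ} (hy : y ∈ Set.Ico 0 b₂) : 0 < 1 - 6 * √2 * y ^ 2 := by
  have h1 := six_mul_sqrt_two_mul_lt hy
  have h2 := hy.2.trans_le b₂_le
  nlinarith [hy.1]

lemma isIncreasingInverse_ell₂ : IsIncreasingInverse g₂ b₂ ell₂ := by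
  refine isIncreasingInverse_of_factor (k := fun y => 1 - 6 * √2 * y ^ 2) (c := 6 * √2)
    b₂_pos b₂_le (by positivity) ?_ (fun y hy => g₂_factor_pos hy) ?_ ?_
  · intro x hx y hy hxy
    have := pow_le_pow_left₀ hx.1 hxy 2
    change 1 - 6 * √2 * y ^ 2 ≤ 1 - 6 * √2 * x ^ 2
    have := mul_le_mul_of_nonneg_left this (show 0 ≤ 6 * √2 by positivity)
    linarith
  · intro y _
    have : 0 ≤ 6 * √2 * y ^ 2 := by positivity
    change 1 - 6 * √2 * y ^ 2 ≤ 1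
    linarith
  · intro y hy
    have : y ^ 2 ≤ y := by nlinarith [hy.1, hy.2.trans_le b₂_le]
    have := mul_le_mul_of_nonneg_left this (show 0 ≤ 6 * √2 by positivity)
    change 1 - 6 * √2 * y ≤ 1 - 6 * √2 * y ^ 2
    linarith

variable {D V : ℝ}

lemma b₃_pos (hV : 0 < V) (hVD : 4 * V ≤ D ^ 2) : 0 < b₃ D V := by
  have : 0 < D ^ 2 := by linarith
  unfold b₃
  positivity

/-- `V / D² ≤ 1/4` and `√2 ≤ 3/2` give `√2 / 12 ≤ 1/8`. -/
lemma b₃_le (hV : 0 < V) (hVD : 4 * V ≤ D ^ 2) : b₃ D V ≤ 1 / 8 := by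
  have : 0 < D ^ 2 := by linarith
  have h2 : √2 ≤ 3 / 2 := Real.sqrt_le_iff.mpr ⟨by norm_num, by norm_num⟩
  rw [b₃, div_le_iff₀ (by positivity)]
  nlinarith

lemma g₃_coeff_mul_lt (hV : 0 < V) (hVD : 4 * V ≤ D ^ 2) {y : ℝ} (hy : y ∈ Set.Ico 0 (b₃ D V)) :
    3 * D ^ 2 * y / (√2 * V) < 1 := by
  have : 0 < D ^ 2 := by linarith
  have h := hy.2
  rw [b₃, lt_div_iff₀ (by positivity)] at h
  rw [div_lt_one (by positivity)]
  linarith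

lemma isIncreasingInverse_ell₃ (hV : 0 < V) (hVD : 4 * V ≤ D ^ 2) :
    IsIncreasingInverse (g₃ D V) (b₃ D V) (ell₃ D V) := by
  have e : ∀ y, 3 * D ^ 2 * y / (√2 * V) = 3 * D ^ 2 / (√2 * V) * y := fun y => by ring
  have hc : 0 ≤ 3 * D ^ 2 / (√2 * V) := by positivity
  refine isIncreasingInverse_of_factor (k := fun y => 1 - 3 * D ^ 2 * y / (√2 * V))
    (c := 3 * D ^ 2 / (√2 * V)) (b₃_pos hV hVD) (b₃_le hV hVD) hc ?_ ?_ ?_ ?_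
  · intro x hx y hy hxy
    simp only [e]
    have := mul_le_mul_of_nonneg_left hxy hc
    linarith
  · intro y hy
    have := g₃_coeff_mul_lt hV hVD hy
    change 0 < 1 - 3 * D ^ 2 * y / (√2 * V)
    linarith
  · intro y hy
    simp only [e]
    have := mul_nonneg hc hy.1
    linarith
  · intro y _
    simp only [e, le_refl]

lemma div_sqrt_lt_div_sqrt {κ s y f h : ℝ} (hκ : 0 < κ) (hs : 0 < s) (hy : 0 < y) (hh : 0 < h)
    (hhs : h < s ^ 2) (hb : (κ * s) ^ 2 ≤ y ^ 2 * f) :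
    0 < f ∧ κ / √f < y / √h := by
  have hf : 0 < f := by
    by_contra hf
    have : 0 < (κ * s) ^ 2 := by positivity
    nlinarith [sq_nonneg y]
  refine ⟨hf, ?_⟩
  rw [div_lt_div_iff₀ (Real.sqrt_pos.mpr hf) (Real.sqrt_pos.mpr hh)]
  calc κ * √h < κ * s := mul_lt_mul_of_pos_left ((Real.sqrt_lt' hs).mpr hhs) hκ
    _ ≤ √(y ^ 2 * f) := Real.le_sqrt_of_sq_le hb
    _ = y * √f := by rw [Real.sqrt_mul (sq_nonneg y), Real.sqrt_sq hy.le]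

/-- The Fisher bound gives the sharper `y / (1 - 2 y²)`. The radicand of `g₂` is at most `1 - 6√2 y²
< 1 - 8 y²`, which is below `(1 - 2 y²)²`. For `F = ∞` the argument is `0`. -/
lemma lt_ofReal_g₂ {Δ y : ℝ} {F : ℝ≥0∞} (hΔ : 0 < Δ) (hy : y ∈ Set.Ico 0 b₂) (hy0 : 0 < y)
    (hF : F ≠ ∞ → (Δ / 2 * (1 - 2 * y ^ 2)) ^ 2 ≤ y ^ 2 * F.toReal) :
    ENNReal.ofReal Δ / (4 * F) ^ (1 / 2 : ℝ) < ENNReal.ofReal (g₂ y) := by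
  have hq := (quartic_bounds (y := y) ⟨hy.1, (hy.2.trans_le b₂_le).le⟩)
  have hh : 0 < (1 - 3 * y ^ 2 + y ^ 4) * (1 - 6 * √2 * y ^ 2) :=
    mul_pos hq.1 (g₂_factor_pos hy)
  have hy8 : y < 1 / 8 := hy.2.trans_le b₂_le
  have hgpos : 0 < g₂ y := div_pos hy0 (Real.sqrt_pos.mpr hh)
  rcases eq_or_ne F ∞ with rfl | hFt
  · simpa [ENNReal.mul_top, ENNReal.top_rpow_of_pos] using hgpos
  have hlt : (1 - 3 * y ^ 2 + y ^ 4) * (1 - 6 * √2 * y ^ 2) < (1 - 2 * y ^ 2) ^ 2 := by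
    have h1 : (1 - 3 * y ^ 2 + y ^ 4) * (1 - 6 * √2 * y ^ 2) ≤ 1 * (1 - 6 * √2 * y ^ 2) :=
      mul_le_mul_of_nonneg_right hq.2.1 (g₂_factor_pos hy).le
    have h2 : 8 * y ^ 2 < 6 * √2 * y ^ 2 :=
      mul_lt_mul_of_pos_right eight_lt_six_mul_sqrt_two (by positivity)
    nlinarith [sq_nonneg (y ^ 2)]
  obtain ⟨hf, hlt⟩ := div_sqrt_lt_div_sqrt (κ := Δ / 2) (by positivity)
    (show 0 < 1 - 2 * y ^ 2 by nlinarith) hy0 hh hlt (hF hFt)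
  have e : ENNReal.ofReal Δ / (4 * F) ^ (1 / 2 : ℝ) = ENNReal.ofReal (Δ / 2 / √F.toReal) := by
    nth_rewrite 1 [← ENNReal.ofReal_toReal hFt]
    rw [show (4 : ℝ≥0∞) = ENNReal.ofReal 4 by simp, ← ENNReal.ofReal_mul (by norm_num),
      ENNReal.ofReal_rpow_of_pos (by positivity), ← ENNReal.ofReal_div_of_pos (by positivity),
      ← Real.sqrt_eq_rpow, Real.sqrt_mul (by norm_num), show (4 : ℝ) = 2 ^ 2 by norm_num,
      Real.sqrt_sq (by norm_num), div_div]
  rw [e]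
  exact (ENNReal.ofReal_lt_ofReal_iff hgpos).mpr hlt

lemma lt_ofReal_g₃ {y : ℝ} {F : ℝ≥0∞} (hD : 0 < D) (hV : 0 < V) (hVD : 4 * V ≤ D ^ 2)
    (hy : y ∈ Set.Ico 0 (b₃ D V)) (hy0 : 0 < y)
    (hF : 0 ≤ √V * (1 - 2 * y ^ 2) - D * y → F ≠ ∞ →
      (√V * (1 - 2 * y ^ 2) - D * y) ^ 2 ≤ y ^ 2 * F.toReal) :
    (ENNReal.ofReal V / F) ^ (1 / 2 : ℝ) < ENNReal.ofReal (g₃ D V y) := by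
  have hy8 : y < 1 / 8 := hy.2.trans_le (b₃_le hV hVD)
  have hq := (quartic_bounds (y := y) ⟨hy.1, hy8.le⟩)
  have hk := g₃_coeff_mul_lt hV hVD hy
  have hh : 0 < (1 - 3 * y ^ 2 + y ^ 4) * (1 - 3 * D ^ 2 * y / (√2 * V)) :=
    mul_pos hq.1 (by linarith)
  have hgpos : 0 < g₃ D V y := div_pos hy0 (Real.sqrt_pos.mpr hh)
  rcases eq_or_ne F ∞ with rfl | hFt
  · simpa [ENNReal.zero_rpow_of_pos] using hgpos
  have hsV : 0 < √V := Real.sqrt_pos.mpr hV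
  have hsV2 : √V ^ 2 = V := Real.sq_sqrt hV.le
  -- In the ratio `k = D / √V ≥ 2` the Fisher bound has the factor `1 - 2 y² - k y`, while the last
  -- factor of `g₃` is at most `1 - 4 k y`. This covers the loss `4 y² + 2 k y` in squaring, as `y <
  -- 1/8`.
  set k := D / √V with hkdef
  have hk0 : 0 < k := div_pos hD hsV
  have hk2 : D ^ 2 = k ^ 2 * V := by
    rw [hkdef, div_pow, hsV2]; field_simp
  have hk4 : 2 ≤ k := by
    have : 4 ≤ k ^ 2 := by
      rw [hk2] at hVD
      nlinarith
    nlinarith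
  have hco : 3 * D ^ 2 * y / (√2 * V) = 3 / √2 * k ^ 2 * y := by
    rw [hk2]; field_simp
  have hs2 : 2 ≤ 3 / √2 := by
    rw [le_div_iff₀ (by positivity)]
    have h2 : √2 ≤ 3 / 2 := Real.sqrt_le_iff.mpr ⟨by norm_num, by norm_num⟩
    linarith
  have hco2 : 4 * k * y ≤ 3 * D ^ 2 * y / (√2 * V) := by
    rw [hco]
    have h1 : 4 * k ≤ 2 * k ^ 2 := by nlinarith
    have h2 : 2 * k ^ 2 ≤ 3 / √2 * k ^ 2 := mul_le_mul_of_nonneg_right hs2 (sq_nonneg k)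
    exact mul_le_mul_of_nonneg_right (h1.trans h2) hy0.le
  have hky : 0 < k * y := mul_pos hk0 hy0
  have hyk : y ≤ k * y := by nlinarith
  have hs : 0 < 1 - 2 * y ^ 2 - k * y := by nlinarith
  have hlt : (1 - 3 * y ^ 2 + y ^ 4) * (1 - 3 * D ^ 2 * y / (√2 * V))
      < (1 - 2 * y ^ 2 - k * y) ^ 2 := by
    have h1 : (1 - 3 * y ^ 2 + y ^ 4) * (1 - 3 * D ^ 2 * y / (√2 * V))
        ≤ 1 * (1 - 3 * D ^ 2 * y / (√2 * V)) :=
      mul_le_mul_of_nonneg_right hq.2.1 (by linarith)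
    have h2 : y ^ 2 ≤ 1 / 8 * y := by nlinarith
    have h3 : 2 * y ≤ k * y := mul_le_mul_of_nonneg_right hk4 hy0.le
    nlinarith [sq_nonneg (2 * y ^ 2 + k * y)]
  have hfac : √V * (1 - 2 * y ^ 2) - D * y = √V * (1 - 2 * y ^ 2 - k * y) := by
    have : D = √V * k := by rw [hkdef]; field_simp
    rw [this]; ring
  rw [hfac] at hF
  obtain ⟨hf, hlt⟩ := div_sqrt_lt_div_sqrt hsV hs hy0 hh hlt (hF (by positivity) hFt)
  have e : (ENNReal.ofReal V / F) ^ (1 / 2 : ℝ) = ENNReal.ofReal (√V / √F.toReal) := by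
    nth_rewrite 1 [← ENNReal.ofReal_toReal hFt]
    rw [← ENNReal.ofReal_div_of_pos hf, ENNReal.ofReal_rpow_of_pos (by positivity),
      ← Real.sqrt_eq_rpow, Real.sqrt_div hV.le]
  rw [e]
  exact (ENNReal.ofReal_lt_ofReal_iff hgpos).mpr hlt

end Scalar

/-! ### Spectral quantities of the logical Hamiltonian -/

section Spectral

variable {L : Type*} [Fintype L] [DecidableEq L] {H : Matrix L L ℂ}

lemma _root_.Matrix.IsHermitian.sub_smul_one_eq_conj (hH : H.IsHermitian) (m : ℝ) :
    H - (m : ℂ) • (1 : Matrix L L ℂ) = (hH.eigenvectorUnitary : Matrix L L ℂ) *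
      diagonal (fun i => ((hH.eigenvalues i - m : ℝ) : ℂ)) *
      star (hH.eigenvectorUnitary : Matrix L L ℂ) := by
  have hU : (hH.eigenvectorUnitary : Matrix L L ℂ) *
      star (hH.eigenvectorUnitary : Matrix L L ℂ) = 1 := by simp
  have hs : H = (hH.eigenvectorUnitary : Matrix L L ℂ) *
      diagonal (fun i => (hH.eigenvalues i : ℂ)) *
      star (hH.eigenvectorUnitary : Matrix L L ℂ) := by
    conv_lhs => rw [hH.spectral_theorem]
    rfl
  have hd : diagonal (fun i => ((hH.eigenvalues i - m : ℝ) : ℂ)) =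
      diagonal (fun i => (hH.eigenvalues i : ℂ)) - (m : ℂ) • (1 : Matrix L L ℂ) := by
    ext i j
    rcases eq_or_ne i j with rfl | h
    · simp
    · simp [h]
  rw [hd, Matrix.mul_sub, Matrix.sub_mul, ← hs, Matrix.mul_smul, Matrix.smul_mul, Matrix.mul_one,
    hU]

lemma _root_.Matrix.IsHermitian.sub_smul_one_pow (hH : H.IsHermitian) (m : ℝ) (k : ℕ) :
    ((H - (m : ℂ) • (1 : Matrix L L ℂ)) ^ k).trace =
      ((∑ i, (hH.eigenvalues i - m) ^ k : ℝ) : ℂ) := by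
  have hU : star (hH.eigenvectorUnitary : Matrix L L ℂ) *
      (hH.eigenvectorUnitary : Matrix L L ℂ) = 1 := by simp
  have hU' : (hH.eigenvectorUnitary : Matrix L L ℂ) *
      star (hH.eigenvectorUnitary : Matrix L L ℂ) = 1 := by simp
  have hk : (H - (m : ℂ) • (1 : Matrix L L ℂ)) ^ k = (hH.eigenvectorUnitary : Matrix L L ℂ) *
      diagonal (fun i => ((hH.eigenvalues i - m : ℝ) : ℂ)) ^ k *
      star (hH.eigenvectorUnitary : Matrix L L ℂ) := by
    rw [hH.sub_smul_one_eq_conj]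
    induction k with
    | zero => simp
    | succ k ih =>
      rw [pow_succ, ih, pow_succ]
      simp only [Matrix.mul_assoc]
      rw [← Matrix.mul_assoc (star _) (hH.eigenvectorUnitary : Matrix L L ℂ), hU, Matrix.one_mul]
  rw [hk, trace_mul_comm, ← Matrix.mul_assoc, hU, Matrix.one_mul, diagonal_pow, trace_diagonal]
  simp

/-- Maximal and minimal eigenvalues. -/
lemma _root_.Matrix.IsHermitian.exists_spread [Nonempty L] (hH : H.IsHermitian) :
    ∃ i j, spread H = hH.eigenvalues i - hH.eigenvalues j ∧
      ∀ k, hH.eigenvalues j ≤ hH.eigenvalues k ∧ hH.eigenvalues k ≤ hH.eigenvalues i := by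
  obtain ⟨i, hi⟩ := Finite.exists_max hH.eigenvalues
  obtain ⟨j, hj⟩ := Finite.exists_min hH.eigenvalues
  refine ⟨i, j, ?_, fun k => ⟨hj k, hi k⟩⟩
  rw [spread, hH.spectrum_real_eq_range_eigenvalues]
  congr 1
  · exact IsGreatest.csSup_eq ⟨⟨i, rfl⟩, by rintro _ ⟨k, rfl⟩; exact hi k⟩
  · exact IsLeast.csInf_eq ⟨⟨j, rfl⟩, by rintro _ ⟨k, rfl⟩; exact hj k⟩

lemma spread_pos [Nonempty L] (hH : H.IsHermitian)
    (hne : ¬ ∃ c : ℂ, H = c • (1 : Matrix L L ℂ)) : 0 < spread H := by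
  obtain ⟨i, j, hs, hij⟩ := hH.exists_spread
  rw [hs]
  by_contra hle
  refine hne ⟨(hH.eigenvalues i : ℂ), sub_eq_zero.mp ?_⟩
  have : ∀ k, hH.eigenvalues k - hH.eigenvalues i = 0 := fun k => by
    have := hij k
    linarith
  rw [hH.sub_smul_one_eq_conj]
  simp [this]

/-- The mean of the eigenvalues. -/
def eigenMean (hH : H.IsHermitian) : ℝ := (∑ i, hH.eigenvalues i) / (Fintype.card L : ℝ)

variable [Nonempty L]

/-- The bias-variance identity, used with `c` the midpoint of the spectrum for Popoviciu and with
`c` the mean elsewhere. -/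
lemma card_mul_mixedVariance (hH : H.IsHermitian) (c : ℝ) :
    ∑ i, (hH.eigenvalues i - c) ^ 2 =
      (Fintype.card L : ℝ) * (mixedVariance H + (eigenMean hH - c) ^ 2) := by
  have hd : (Fintype.card L : ℝ) ≠ 0 := Nat.cast_ne_zero.mpr Fintype.card_ne_zero
  have h1 := hH.sub_smul_one_pow 0 1
  have h2 := hH.sub_smul_one_pow 0 2
  simp only [Complex.ofReal_zero, zero_smul, sub_zero, pow_one, pow_two H] at h1 h2
  have e : ∑ i, (hH.eigenvalues i - c) ^ 2 = ∑ i, hH.eigenvalues i ^ 2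
      - 2 * c * ∑ i, hH.eigenvalues i + (Fintype.card L : ℝ) * c ^ 2 := by
    simp only [sub_sq, Finset.sum_add_distrib, Finset.sum_sub_distrib, Finset.mul_sum,
      Finset.sum_const, Finset.card_univ, nsmul_eq_mul]
    congr 2
    exact Finset.sum_congr rfl fun _ _ => by ring
  rw [e, mixedVariance, eigenMean, h1, h2, Complex.ofReal_re, Complex.ofReal_re]
  field_simp
  ring

/-- Popoviciu's inequality. -/
lemma four_mul_mixedVariance_le (hH : H.IsHermitian) : 4 * mixedVariance H ≤ spread H ^ 2 := by
  have hd : (0 : ℝ) < Fintype.card L := Nat.cast_pos.mpr Fintype.card_pos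
  obtain ⟨i, j, hs, hij⟩ := hH.exists_spread
  set c := (hH.eigenvalues i + hH.eigenvalues j) / 2 with hc
  have h1 : ∑ k, (hH.eigenvalues k - c) ^ 2 ≤ ∑ _k : L, (spread H / 2) ^ 2 := by
    refine Finset.sum_le_sum fun k _ => ?_
    have := hij k
    rw [hs, hc]
    nlinarith
  rw [card_mul_mixedVariance, Finset.sum_const, Finset.card_univ, nsmul_eq_mul] at h1
  have h2 := le_of_mul_le_mul_left h1 hd
  nlinarith [sq_nonneg (eigenMean hH - c)]

lemma mixedVariance_pos (hH : H.IsHermitian)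
    (hne : ¬ ∃ c : ℂ, H = c • (1 : Matrix L L ℂ)) : 0 < mixedVariance H := by
  have hd : (0 : ℝ) < Fintype.card L := Nat.cast_pos.mpr Fintype.card_pos
  have h := card_mul_mixedVariance hH (eigenMean hH)
  have h0 : 0 ≤ ∑ i, (hH.eigenvalues i - eigenMean hH) ^ 2 :=
    Finset.sum_nonneg fun _ _ => sq_nonneg _
  rw [sub_self, zero_pow two_ne_zero, add_zero] at h
  rcases h0.lt_or_eq with h1 | h1
  · rw [h] at h1
    exact pos_of_mul_pos_right h1 hd.le
  · refine absurd ⟨(eigenMean hH : ℂ), sub_eq_zero.mp ?_⟩ hne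
    rw [hH.sub_smul_one_eq_conj]
    have := (Finset.sum_eq_zero_iff_of_nonneg fun _ _ => sq_nonneg _).mp h1.symm
    have hz : ∀ k, hH.eigenvalues k - eigenMean hH = 0 := fun k =>
      pow_eq_zero_iff two_ne_zero |>.mp (this k (Finset.mem_univ k))
    simp [hz]

/-- No eigenvalue deviates from the mean by more than the spread. This bounds the residual in
`exists_entangled_vectors`. -/
lemma sum_fourth_le (hH : H.IsHermitian) :
    ∑ i, (hH.eigenvalues i - eigenMean hH) ^ 4 ≤
      spread H ^ 2 * ((Fintype.card L : ℝ) * mixedVariance H) := by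
  have hd : (0 : ℝ) < Fintype.card L := Nat.cast_pos.mpr Fintype.card_pos
  obtain ⟨i, j, hs, hij⟩ := hH.exists_spread
  have hm1 : hH.eigenvalues j ≤ eigenMean hH := by
    rw [eigenMean, le_div_iff₀ hd, mul_comm, ← nsmul_eq_mul, ← Finset.card_univ]
    exact Finset.card_nsmul_le_sum _ _ _ fun k _ => (hij k).1
  have hm2 : eigenMean hH ≤ hH.eigenvalues i := by
    rw [eigenMean, div_le_iff₀ hd, mul_comm, ← nsmul_eq_mul, ← Finset.card_univ]
    exact Finset.sum_le_card_nsmul _ _ _ fun k _ => (hij k).2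
  have h := card_mul_mixedVariance hH (eigenMean hH)
  rw [sub_self, zero_pow two_ne_zero, add_zero] at h
  rw [← h, Finset.mul_sum]
  refine Finset.sum_le_sum fun k _ => ?_
  have hk := hij k
  have h2 : (hH.eigenvalues k - eigenMean hH) ^ 2 ≤ spread H ^ 2 := by
    rw [hs]
    exact sq_le_sq' (by linarith) (by linarith)
  calc (hH.eigenvalues k - eigenMean hH) ^ 4 =
        (hH.eigenvalues k - eigenMean hH) ^ 2 * (hH.eigenvalues k - eigenMean hH) ^ 2 := by ring
    _ ≤ _ := mul_le_mul_of_nonneg_right h2 (sq_nonneg _)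

lemma star_eigenvectorBasis_dotProduct (hH : H.IsHermitian) (i j : L) :
    star ⇑(hH.eigenvectorBasis i) ⬝ᵥ ⇑(hH.eigenvectorBasis j) = if i = j then 1 else 0 := by
  have := orthonormal_iff_ite.mp hH.eigenvectorBasis.orthonormal i j
  rwa [EuclideanSpace.inner_eq_star_dotProduct, dotProduct_comm] at this

end Spectral

/-! ### Bipartite vectors as matrices -/

section Bipartite

variable {L : Type*} [Fintype L] [DecidableEq L]

/-- The bipartite vector with the coefficient matrix `M`. -/
def pairVec (M : Matrix L L ℂ) (p : L × L) : ℂ := M p.1 p.2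

lemma star_pairVec_dotProduct (M N : Matrix L L ℂ) :
    star (pairVec M) ⬝ᵥ pairVec N = (Mᴴ * N).trace := by
  simp only [dotProduct, Fintype.sum_prod_type_right, trace, diag_apply, Matrix.mul_apply,
    conjTranspose_apply]
  rfl

lemma kronecker_one_mulVec_pairVec (H M : Matrix L L ℂ) :
    (H ⊗ₖ (1 : Matrix L L ℂ)) *ᵥ pairVec M = pairVec (H * M) := by
  ext ⟨a, b⟩
  simp [mulVec, dotProduct, Fintype.sum_prod_type, pairVec, Matrix.one_apply, Matrix.mul_apply]

lemma pairVec_add (M N : Matrix L L ℂ) : pairVec (M + N) = pairVec M + pairVec N := rfl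

lemma pairVec_smul (c : ℂ) (M : Matrix L L ℂ) : pairVec (c • M) = c • pairVec M := rfl

lemma maxVec_eq_pairVec :
    maxVec L = pairVec (((√(Fintype.card L : ℝ) : ℝ) : ℂ)⁻¹ • (1 : Matrix L L ℂ)) := by
  ext p
  simp [maxVec, pairVec, Matrix.one_apply]

lemma star_pairVec_vecMulVec_dotProduct (a b : L → ℂ) (l : L) :
    star (pairVec (vecMulVec a (Pi.single l 1))) ⬝ᵥ pairVec (vecMulVec b (Pi.single l 1)) =
      star a ⬝ᵥ b := by
  rw [star_pairVec_dotProduct, conjTranspose_vecMulVec, vecMulVec_mul_vecMulVec]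
  simp

end Bipartite

/-! ### Test vectors -/

section TestVectors

variable {L : Type*} [Fintype L] [DecidableEq L] [Nonempty L] {H : Matrix L L ℂ}

/-- The superpositions of the extremal eigenvectors. -/
lemma exists_extremal_vectors (hH : H.IsHermitian) (hpos : 0 < spread H) :
    ∃ (ψ u : L × L → ℂ) (m : ℝ), star ψ ⬝ᵥ ψ = 1 ∧ star u ⬝ᵥ u = 1 ∧ star ψ ⬝ᵥ u = 0 ∧
      (H ⊗ₖ (1 : Matrix L L ℂ)) *ᵥ ψ = (m : ℂ) • ψ + ((spread H / 2 : ℝ) : ℂ) • u ∧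
      (H ⊗ₖ (1 : Matrix L L ℂ)) *ᵥ u = (m : ℂ) • u + ((spread H / 2 : ℝ) : ℂ) • ψ := by
  obtain ⟨i, j, hs, -⟩ := hH.exists_spread
  have hij : i ≠ j := by
    rintro rfl
    rw [sub_self] at hs
    exact hpos.ne' hs
  set v : L → ℂ := ⇑(hH.eigenvectorBasis i) with hv
  set w : L → ℂ := ⇑(hH.eigenvectorBasis j) with hw
  set l : L := Classical.arbitrary L
  set r : ℂ := ((√(2 : ℝ) : ℝ) : ℂ)⁻¹ with hr
  have hrr : r * r = 2⁻¹ := by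
    have := inv_sqrt_mul_inv_sqrt (d := 2) (by norm_num)
    rw [hr, this]
    norm_num
  have hrs : star r = r := by simp [hr]
  have hvv : star v ⬝ᵥ v = 1 := by simpa using star_eigenvectorBasis_dotProduct hH i i
  have hww : star w ⬝ᵥ w = 1 := by simpa using star_eigenvectorBasis_dotProduct hH j j
  have hvw : star v ⬝ᵥ w = 0 := by simpa [hij] using star_eigenvectorBasis_dotProduct hH i j
  have hwv : star w ⬝ᵥ v = 0 := by simpa [hij.symm] using star_eigenvectorBasis_dotProduct hH j i
  have hHv : H *ᵥ v = (hH.eigenvalues i : ℂ) • v := hH.mulVec_eigenvectorBasis i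
  have hHw : H *ᵥ w = (hH.eigenvalues j : ℂ) • w := hH.mulVec_eigenvectorBasis j
  -- No entanglement is needed: the reference sits in a basis vector `l`. With `m` the midpoint of
  -- the spectrum, `H - m` swaps `(v + w)/√2` and `(v - w)/√2` with coefficient half the spread,
  -- leaving no residual.
  refine ⟨pairVec (vecMulVec (r • (v + w)) (Pi.single l 1)),
    pairVec (vecMulVec (r • (v - w)) (Pi.single l 1)),
    (hH.eigenvalues i + hH.eigenvalues j) / 2, ?_, ?_, ?_, ?_, ?_⟩
  · rw [star_pairVec_vecMulVec_dotProduct]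
    simp only [star_smul, star_add, smul_dotProduct, dotProduct_smul, add_dotProduct,
      dotProduct_add, hvv, hww, hvw, hwv, smul_eq_mul, hrs]
    linear_combination 2 * hrr
  · rw [star_pairVec_vecMulVec_dotProduct]
    simp only [star_smul, star_sub, smul_dotProduct, dotProduct_smul, sub_dotProduct,
      dotProduct_sub, hvv, hww, hvw, hwv, smul_eq_mul, hrs]
    linear_combination 2 * hrr
  · rw [star_pairVec_vecMulVec_dotProduct]
    simp only [star_smul, star_add, smul_dotProduct, dotProduct_smul, add_dotProduct,
      dotProduct_sub, hvv, hww, hvw, hwv, smul_eq_mul]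
    norm_num
  · rw [kronecker_one_mulVec_pairVec, ← pairVec_smul, ← pairVec_smul, ← pairVec_add,
      mul_vecMulVec, mulVec_smul, mulVec_add, hHv, hHw, ← smul_vecMulVec, ← smul_vecMulVec,
      ← add_vecMulVec, hs]
    congr 2
    ext a
    simp only [Pi.add_apply, Pi.sub_apply, Pi.smul_apply, smul_eq_mul]
    push_cast
    ring
  · rw [kronecker_one_mulVec_pairVec, ← pairVec_smul, ← pairVec_smul, ← pairVec_add,
      mul_vecMulVec, mulVec_smul, mulVec_sub, hHv, hHw, ← smul_vecMulVec, ← smul_vecMulVec,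
      ← add_vecMulVec, hs]
    congr 2
    ext a
    simp only [Pi.add_apply, Pi.sub_apply, Pi.smul_apply, smul_eq_mul]
    push_cast
    ring

/-- The action of the Hamiltonian on the maximally entangled vector. -/
lemma exists_entangled_vectors (hH : H.IsHermitian) (hV : 0 < mixedVariance H) :
    ∃ (u x : L × L → ℂ) (m : ℝ), star u ⬝ᵥ u = 1 ∧ star (maxVec L) ⬝ᵥ u = 0 ∧
      star (maxVec L) ⬝ᵥ x = 0 ∧ (star x ⬝ᵥ x).re ≤ spread H ^ 2 ∧
      (H ⊗ₖ (1 : Matrix L L ℂ)) *ᵥ maxVec L =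
        (m : ℂ) • maxVec L + ((√(mixedVariance H) : ℝ) : ℂ) • u ∧
      (H ⊗ₖ (1 : Matrix L L ℂ)) *ᵥ u =
        (m : ℂ) • u + ((√(mixedVariance H) : ℝ) : ℂ) • maxVec L + x := by
  have hd : (0 : ℝ) < Fintype.card L := Nat.cast_pos.mpr Fintype.card_pos
  set d : ℝ := (Fintype.card L : ℝ) with hd_def
  set V := mixedVariance H with hVdef
  set m := eigenMean hH with hm
  set K := H - (m : ℂ) • (1 : Matrix L L ℂ) with hK
  have hKh : Kᴴ = K := by
    rw [hK, conjTranspose_sub, conjTranspose_smul, conjTranspose_one, hH.eq, Complex.star_def,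
      Complex.conj_ofReal]
  have hHK : H = (m : ℂ) • (1 : Matrix L L ℂ) + K := by rw [hK]; abel
  have hsum1 : ∑ i, (hH.eigenvalues i - m) = 0 := by
    rw [Finset.sum_sub_distrib, Finset.sum_const, Finset.card_univ, nsmul_eq_mul, hm, eigenMean,
      mul_div_cancel₀ _ hd.ne', sub_self]
  have hsum2 : ∑ i, (hH.eigenvalues i - m) ^ 2 = d * V := by
    rw [card_mul_mixedVariance, ← hm, sub_self, zero_pow two_ne_zero, add_zero]
  have hK1 : K.trace = 0 := by
    have := hH.sub_smul_one_pow m 1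
    simp only [pow_one] at this
    rw [hK, this, hsum1, Complex.ofReal_zero]
  have hK2 : (K * K).trace = ((d * V : ℝ) : ℂ) := by
    rw [← pow_two, hK, hH.sub_smul_one_pow, hsum2]
  have hK4 : ((K * K) * (K * K)).trace.re ≤ spread H ^ 2 * (d * V) := by
    have := hH.sub_smul_one_pow m 4
    rw [← hK, show K ^ 4 = (K * K) * (K * K) by noncomm_ring] at this
    rw [this, Complex.ofReal_re]
    exact sum_fourth_le hH
  set r : ℂ := ((√d : ℝ) : ℂ)⁻¹ with hr
  set q : ℂ := ((√V : ℝ) : ℂ)⁻¹ with hq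
  have hrr : r * r = (d : ℂ)⁻¹ := inv_sqrt_mul_inv_sqrt hd.le
  have hqq : q * q = (V : ℂ)⁻¹ := inv_sqrt_mul_inv_sqrt hV.le
  have hrs : star r = r := by simp [hr]
  have hqs : star q = q := by simp [hq]
  have hdC : (d : ℂ) ≠ 0 := Complex.ofReal_ne_zero.mpr hd.ne'
  have hVC : (V : ℂ) ≠ 0 := Complex.ofReal_ne_zero.mpr hV.ne'
  have hsq : ((√V : ℝ) : ℂ) * q = 1 :=
    mul_inv_cancel₀ (Complex.ofReal_ne_zero.mpr (Real.sqrt_pos.mpr hV).ne')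
  have hsV : ((√V : ℝ) : ℂ) = q * V := by
    have : ((√V : ℝ) : ℂ) * ((√V : ℝ) : ℂ) = (V : ℂ) := by
      rw [← Complex.ofReal_mul, Real.mul_self_sqrt hV.le]
    rw [← this, ← mul_assoc, mul_comm q, hsq, one_mul]
  have htr1 : (1 : Matrix L L ℂ).trace = (d : ℂ) := by
    rw [trace_one, hd_def, Complex.ofReal_natCast]
  rw [maxVec_eq_pairVec, ← hr]
  -- As matrices, `maxVec` is `1/√d`. `K = H - m` sends it to `√V u` with `u = K/√(dV)`, and sends
  -- `u` to `K²/√(dV)`, whose component along `maxVec` is `√V`; the rest is `x`.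
  refine ⟨pairVec ((r * q) • K), pairVec ((r * q) • (K * K - (V : ℂ) • (1 : Matrix L L ℂ))), m,
    ?_, ?_, ?_, ?_, ?_, ?_⟩
  · rw [star_pairVec_dotProduct, conjTranspose_smul, hKh, Matrix.smul_mul, Matrix.mul_smul,
      trace_smul, trace_smul, hK2, star_mul, hrs, hqs]
    simp only [smul_eq_mul]
    calc q * r * (r * q * ((d * V : ℝ) : ℂ)) = (r * r) * (q * q) * (d * V) := by push_cast; ring
      _ = 1 := by rw [hrr, hqq]; field_simp
  · rw [star_pairVec_dotProduct, conjTranspose_smul, conjTranspose_one, Matrix.smul_mul,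
      Matrix.mul_smul, Matrix.one_mul, trace_smul, trace_smul, hK1]
    simp
  · rw [star_pairVec_dotProduct, conjTranspose_smul, conjTranspose_one, Matrix.smul_mul,
      Matrix.mul_smul, Matrix.one_mul, trace_smul, trace_smul, trace_sub, trace_smul, hK2, htr1]
    simp [mul_comm]
  · rw [star_pairVec_dotProduct, conjTranspose_smul, conjTranspose_sub, conjTranspose_mul,
      conjTranspose_smul, conjTranspose_one, hKh, Matrix.smul_mul, Matrix.mul_smul,
      trace_smul, trace_smul, star_mul, hrs, hqs, Complex.star_def, Complex.conj_ofReal,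
      smul_eq_mul, smul_eq_mul]
    -- Thus `‖x‖² = (Tr K⁴ - d V²)/(d V)`, at most the squared spread by the fourth-moment bound.
    have e : ((K * K - (V : ℂ) • (1 : Matrix L L ℂ)) * (K * K - (V : ℂ) • (1 : Matrix L L ℂ))).trace
        = ((K * K) * (K * K)).trace - ((d * V ^ 2 : ℝ) : ℂ) := by
      simp only [Matrix.mul_sub, Matrix.sub_mul, Matrix.mul_smul, Matrix.smul_mul, Matrix.mul_one,
        Matrix.one_mul, trace_sub, trace_smul, hK2, htr1, smul_eq_mul]
      push_cast
      ring
    rw [e, show ∀ z : ℂ, q * r * (r * q * z) = ((d * V : ℝ) : ℂ)⁻¹ * z from fun z => by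
      calc q * r * (r * q * z) = (r * r) * (q * q) * z := by ring
        _ = _ := by rw [hrr, hqq]; push_cast; rw [mul_inv],
      ← Complex.ofReal_inv, Complex.re_ofReal_mul, Complex.sub_re, Complex.ofReal_re,
      inv_mul_le_iff₀ (by positivity)]
    have : 0 ≤ d * V ^ 2 := by positivity
    linarith
  · rw [kronecker_one_mulVec_pairVec, ← pairVec_smul, ← pairVec_smul, ← pairVec_add,
      Matrix.mul_smul, Matrix.mul_one, smul_smul, smul_smul,
      show ((√V : ℝ) : ℂ) * (r * q) = r by rw [mul_left_comm, hsq, mul_one],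
      mul_comm (m : ℂ), ← smul_smul, ← smul_add, ← hHK]
  · rw [kronecker_one_mulVec_pairVec, ← pairVec_smul, ← pairVec_smul, ← pairVec_add,
      ← pairVec_add, hsV]
    congr 1
    nth_rewrite 1 [hHK]
    simp only [Matrix.add_mul, Matrix.mul_smul, Matrix.smul_mul, Matrix.one_mul, smul_sub,
      smul_smul]
    rw [show q * (V : ℂ) * r = r * q * V by ring, mul_comm (m : ℂ) (r * q), smul_add, smul_smul]
    abel

end TestVectors

/-! ### Lower bounds on the gate error -/

section Lower

variable {L S : Type*} [Fintype L] [DecidableEq L] [Nonempty L] [Fintype S] [DecidableEq S]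
  {HL : Matrix L L ℂ} {HS : Matrix S S ℂ} {E : Matrix L L ℂ →ₗ[ℂ] Matrix S S ℂ}
  {N : Matrix S S ℂ →ₗ[ℂ] Matrix S S ℂ}

/-- The test state is the superposition of extremal eigenvectors, with `κ` half the spread and zero
residual. -/
lemma ell₂_le_gateError (hHL : HL.IsHermitian) (hHS : HS.IsHermitian)
    (hne : ¬ ∃ c : ℂ, HL = c • (1 : Matrix L L ℂ)) {τ : ℝ} (hτ : 0 < τ)
    (hLτ : ∀ θ, evol HL (θ + τ) = evol HL θ) (hSτ : ∀ θ, evol HS (θ + τ) = evol HS θ)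
    (hE : IsChannel E) (hN : IsChannel N) (θ : ℝ) :
    ell₂ (ENNReal.ofReal (spread HL) / (4 * rldChannel (noisyGate N HS) θ) ^ (1 / 2 : ℝ)) ≤
      gateError HL HS N E := by
  have : Nonempty {R : Matrix S S ℂ →ₗ[ℂ] Matrix L L ℂ // IsChannel R} := nonempty_channel
  have hD := spread_pos hHL hne
  refine inverseOn_le (Real.iInf_nonneg fun R => Real.iSup_nonneg fun θ => Real.sqrt_nonneg _) ?_
  intro y hy hlt
  obtain ⟨R, hR⟩ := exists_lt_of_ciInf_lt hlt
  have hy0 : 0 < y := (Real.iSup_nonneg fun θ => Real.sqrt_nonneg _).trans_lt hR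
  have hy8 : y < 1 / 8 := hy.2.trans_le b₂_le
  obtain ⟨ψ, u, m, hψ, hu, hψu, hKψ, hKu⟩ := exists_extremal_vectors hHL hD
  refine lt_ofReal_g₂ hD hy hy0 fun hF => ?_
  have hc : 0 ≤ spread HL / 2 * (1 - 2 * y ^ 2) - 0 * y := by
    have : 0 ≤ 1 - 2 * y ^ 2 := by nlinarith
    have := mul_nonneg (half_pos hD).le this
    linarith
  have := rldChannel_noisyGate_bound (x := 0) (ξ := 0) hHL hHS hτ hLτ hSτ hE hN R.2 hy.1 le_rfl
    (half_pos hD).le hψ hu hψu (by simp) (by simp) hKψ (by rw [hKu, add_zero])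
    (fun t => (sine_fidelity_le_purifiedDist (isState_vecMulVec hψ)).trans
      ((le_ciSup (bddAbove_purifiedDist (fun t => R.1 ∘ₗ noisyGate N HS t ∘ₗ E)
        (fun t => evolChannel HL t)) t).trans hR.le)) hc θ hF
  rwa [zero_mul, sub_zero] at this

/-- The Choi distance only sees the maximally entangled input, so this must be the test state: `κ =
√V`, and the residual bound `ξ` is the spread. -/
lemma ell₃_le_choiGateError (hHL : HL.IsHermitian) (hHS : HS.IsHermitian)
    (hne : ¬ ∃ c : ℂ, HL = c • (1 : Matrix L L ℂ)) {τ : ℝ} (hτ : 0 < τ)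
    (hLτ : ∀ θ, evol HL (θ + τ) = evol HL θ) (hSτ : ∀ θ, evol HS (θ + τ) = evol HS θ)
    (hE : IsChannel E) (hN : IsChannel N) (θ : ℝ) :
    ell₃ (spread HL) (mixedVariance HL)
        ((ENNReal.ofReal (mixedVariance HL) / rldChannel (noisyGate N HS) θ) ^ (1 / 2 : ℝ)) ≤
      choiGateError HL HS N E := by
  have : Nonempty {R : Matrix S S ℂ →ₗ[ℂ] Matrix L L ℂ // IsChannel R} := nonempty_channel
  have hD := spread_pos hHL hne
  have hV := mixedVariance_pos hHL hne
  refine inverseOn_le (Real.iInf_nonneg fun R => Real.iSup_nonneg fun θ => Real.sqrt_nonneg _) ?_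
  intro y hy hlt
  obtain ⟨R, hR⟩ := exists_lt_of_ciInf_lt hlt
  have hy0 : 0 < y := (Real.iSup_nonneg fun θ => Real.sqrt_nonneg _).trans_lt hR
  obtain ⟨u, x, m, hu, hψu, hψx, hx, hKψ, hKu⟩ := exists_entangled_vectors hHL hV
  refine lt_ofReal_g₃ hD hV (four_mul_mixedVariance_le hHL) hy hy0 fun hc hF => ?_
  refine rldChannel_noisyGate_bound hHL hHS hτ hLτ hSτ hE hN R.2 hy.1 hD.le
    (Real.sqrt_nonneg _) star_maxVec_dotProduct hu hψu hψx hx hKψ hKu (fun t => ?_) hc θ hF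
  rw [← maxEntangled_eq]
  exact (le_ciSup (bddAbove_choiPurifiedDist (fun t => R.1 ∘ₗ noisyGate N HS t ∘ₗ E)
    (fun t => evolChannel HL t)) t).trans hR.le

end Lower

end QuantumCode

end

theorem theorem14 {L S : Type*} [Fintype L] [DecidableEq L] [Fintype S] [DecidableEq S]
    (HL : Matrix L L ℂ) (HS : Matrix S S ℂ)
    (hHL : HL.IsHermitian) (hHS : HS.IsHermitian)
    (hHL_nontrivial : ¬ ∃ c : ℂ, HL = c • (1 : Matrix L L ℂ))
    (h_period : ∃ τ : ℝ, 0 < τ ∧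
      (∀ θ : ℝ, QuantumCode.evol HL (θ + τ) = QuantumCode.evol HL θ) ∧
      (∀ θ : ℝ, QuantumCode.evol HS (θ + τ) = QuantumCode.evol HS θ))
    (E : Matrix L L ℂ →ₗ[ℂ] Matrix S S ℂ) (hE : QuantumCode.IsChannel E)
    (N : Matrix S S ℂ →ₗ[ℂ] Matrix S S ℂ) (hN : QuantumCode.IsChannel N)
    (h_comm : ∀ θ : ℝ, N ∘ₗ QuantumCode.evolChannel HS θ = QuantumCode.evolChannel HS θ ∘ₗ N) :
    (QuantumCode.IsIncreasingInverse QuantumCode.g₂ QuantumCode.b₂ QuantumCode.ell₂ ∧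
      QuantumCode.gateError HL HS N E ≤
        QuantumCode.qecInaccuracy N E + QuantumCode.covViolation HL HS E ∧
      ∀ θ : ℝ, QuantumCode.ell₂ (ENNReal.ofReal (QuantumCode.spread HL) /
          (4 * QuantumCode.rldChannel (QuantumCode.noisyGate N HS) θ) ^ (1 / 2 : ℝ)) ≤
        QuantumCode.gateError HL HS N E) ∧
    (QuantumCode.IsIncreasingInverse
        (QuantumCode.g₃ (QuantumCode.spread HL) (QuantumCode.mixedVariance HL))
        (QuantumCode.b₃ (QuantumCode.spread HL) (QuantumCode.mixedVariance HL))
        (QuantumCode.ell₃ (QuantumCode.spread HL) (QuantumCode.mixedVariance HL)) ∧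
      QuantumCode.choiGateError HL HS N E ≤
        QuantumCode.choiQecInaccuracy N E + QuantumCode.choiCovViolation HL HS E ∧
      ∀ θ : ℝ, QuantumCode.ell₃ (QuantumCode.spread HL) (QuantumCode.mixedVariance HL)
          ((ENNReal.ofReal (QuantumCode.mixedVariance HL) /
            QuantumCode.rldChannel (QuantumCode.noisyGate N HS) θ) ^ (1 / 2 : ℝ)) ≤
        QuantumCode.choiGateError HL HS N E) := by
  obtain ⟨τ, hτ, hLτ, hSτ⟩ := h_period
  -- On an empty index set every matrix is a multiple of the identity.
  have hL : Nonempty L := by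
    by_contra h
    rw [not_nonempty_iff] at h
    exact hHL_nontrivial ⟨0, Subsingleton.elim _ _⟩
  exact ⟨⟨QuantumCode.isIncreasingInverse_ell₂, QuantumCode.gateError_le hHL hHS hE hN,
      QuantumCode.ell₂_le_gateError hHL hHS hHL_nontrivial hτ hLτ hSτ hE hN⟩,
    ⟨QuantumCode.isIncreasingInverse_ell₃ (QuantumCode.mixedVariance_pos hHL hHL_nontrivial)
        (QuantumCode.four_mul_mixedVariance_le hHL),
      QuantumCode.choiGateError_le hHL hHS hE hN,
      QuantumCode.ell₃_le_choiGateError hHL hHS hHL_nontrivial hτ hLτ hSτ hE hN⟩⟩
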